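/- \textbf{Setting.} Let $\mathfrak k$ be a finite-dimensional real inner product space (for example the Lie algebra of a connected, simply connected compact Lie group with an Ad-invariant inner product) and let $H=L^2(S^1;\mathfrak k)$, $S^1=\mathbb R/\mathbb Z$, be the Hilbert space of square-integrable connections on the circle, with $\|A\|^2=\int_0^1|A(\tau)|^2\,d\tau$. Let $(e_i)_{i\in I}$ be any orthonormal basis of $H$. Let $\mathcal A=\mathbb R^I$ be the space of generalized connections $A=\sum_i x_i e_i$ and $\mathcal A_{\mathbb C}=\mathbb C^I$ its complexification. Let $\hbar>0$, $s>\hbar/2$ and $r=2s-\hbar>0$. Let $P_s$ be the Gaussian measure on $\mathcal A$ that is the product of the measures $(2\pi s)^{-1/2}e^{-x^2/2s}\,dx$ on $\mathbb R$, and let $M_{s,\hbar}$ be the Gaussian measure on $\mathcal A_{\mathbb C}$ that is the product of the measures $(\pi\hbar)^{-1/2}(\pi r)^{-1/2}e^{-q^2/r}e^{-p^2/\hbar}\,dq\,dp$ on $\mathbb C\ni q+ip$. For $h\in H$ put $\langle h,A\rangle=\sum_i\langle h,e_i\rangle x_i$ and $\langle h,Z\rangle=\sum_i\langle h,e_i\rangle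 z_i$, where the sums converge in $L^2(\mathcal A,P_s)$ and in $L^2(\mathcal A_{\mathbb C},M_{s,\hbar})$. A cylinder function in $L^2(\mathcal A,P_s)$ is an $f$ of the form $f(A)=\varphi(\langle h_1,A\rangle,\dots,\langle h_n,A\rangle)$ a.e., with $n\ge 0$, $h_1,\dots,h_n$ orthonormal in $H$ and $\varphi:\mathbb R^n\to\mathbb C$ square-integrable for $(2\pi s)^{-n/2}e^{-q^2/2s}\,dq$. On such functions $\Delta_{\mathcal A}$ is the Laplacian in the $n$ variables $\langle h_k,A\rangle$, and $e^{\hbar\Delta_{\mathcal A}/2}f$ is given by $$(e^{\hbar\Delta/2}\varphi)(x)=(2\pi\hbar)^{-n/2}\int_{\mathbb R^n}e^{-(x-q)^2/2\hbar}\varphi(q)\,dq .$$ If $\Phi$ is an entire function on $\mathbb C^n$ that extends $e^{\hbar\Delta/2}\varphi$, then the analytic continuation of $e^{\hbar\Delta_{\mathcal A}/2}f$ is $(S_{s,\hbar}f)(Z)=\Phi(\langle h_1,Z\rangle,\dots,\langle h_n,Z\rangle)$. A holomorphic cylinder function is a function $\Phi(\langle h_1,Z\rangle,\dots,\langle h_n,Z\rangle)$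 with $h_1,\dots,h_n$ orthonormal in $H$ and $\Phi$ entire on $\mathbb C^n$. Let $\mathcal HL^2(\mathcal A_{\mathbb C},M_{s,\hbar})$ be the closure in $L^2(\mathcal A_{\mathbb C},M_{s,\hbar})$ of the space of square-integrable holomorphic cylinder functions. \textbf{Theorem.} For all $\hbar>0$ and $s>\hbar/2$: (1) ($S_{s,\hbar}$ makes sense on cylinder functions.) For every $n$, all orthonormal $h_1,\dots,h_n$ and every $\varphi$ as above, $\varphi(\langle h_1,A\rangle,\dots,\langle h_n,A\rangle)$ is in $L^2(\mathcal A,P_s)$, the integral that defines $e^{\hbar\Delta/2}\varphi$ converges absolutely at every $x\in\mathbb R^n$, there is exactly one entire extension $\Phi$ of $e^{\hbar\Delta/2}\varphi$ to $\mathbb C^n$, and $\Phi(\langle h_1,Z\rangle,\dots,\langle h_n,Z\rangle)$ is in $L^2(\mathcal A_{\mathbb C},M_{s,\hbar})$. The element $S_{s,\hbar}f$ of $L^2(\mathcal A_{\mathbb C},M_{s,\hbar})$ depends only on the cylinder function $f\in L^2(\mathcal A,P_s)$, not on its representation by $h_1,\dots,h_n$ and $\varphi$. (2) For all cylinder functions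 $f,g$ one has $S_{s,\hbar}f\in\mathcal HL^2(\mathcal A_{\mathbb C},M_{s,\hbar})$, $\|S_{s,\hbar}f\|=\|f\|$ and $\|S_{s,\hbar}f-S_{s,\hbar}g\|=\|f-g\|$. (3) The cylinder functions are dense in $L^2(\mathcal A,P_s)$, and $S_{s,\hbar}$ extends uniquely to a unitary map of $L^2(\mathcal A,P_s)$ onto $\mathcal HL^2(\mathcal A_{\mathbb C},M_{s,\hbar})$. -/

import Mathlib

open MeasureTheory ProbabilityTheory
open scoped ENNReal NNReal

noncomputable section

namespace SegalBargmann

/-! ### Connections on the circle -/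

/-- The Hilbert space of square-integrable connections on the circle `ℝ / ℤ`: `𝔨`-valued functions
with squared norm `∫₀¹ |A(τ)|² dτ`. It is the Hilbert space whose norm enters the formal expression
`c e^{-‖A‖² / 2s} 𝒟A` of the Gaussian measure. -/
abbrev L2Connection (𝔨 : Type*) [NormedAddCommGroup 𝔨] [InnerProductSpace ℝ 𝔨] : Type _ :=
  Lp 𝔨 2 (volume : Measure UnitAddCircle)

/-- The enlarged (topological vector) space of generalized connections `∑ i, x i • e i` on which the
Gaussian measure lives, in the coordinates `x i` with respect to an orthonormal basis
`(e i)` of `L2Connection 𝔨`; the square-integrable connections are the square-summable `x`. -/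
abbrev Connection (ι : Type*) : Type _ := ι → ℝ

/-- The complexification `𝒜 + i𝒜` of the space of generalized connections. -/
abbrev ComplexConnection (ι : Type*) : Type _ := ι → ℂ

/-! ### The Gaussian measures -/

/-- The measure `(2πs)^{-d/2} e^{-q²/2s} dq` on `ℝ^d`. -/
def gaussian (d : ℕ) (s : ℝ) : Measure (Fin d → ℝ) :=
  Measure.pi fun _ => gaussianReal 0 s.toNNReal

/-- The measure `P_s` on the space of connections: the coordinates with respect to an orthonormal
basis are independent centered Gaussian variables of variance `s`. -/
def realMeasure (ι : Type*) (s : ℝ) : Measure (Connection ι) :=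
  Measure.infinitePi fun _ => gaussianReal 0 s.toNNReal

/-- The measure `(πħ)^{-1/2} (πr)^{-1/2} e^{-q²/r} e^{-p²/ħ} dq dp`, `r = 2s - ħ`, on `ℂ`, with
`z = q + ip`: here `q` and `p` are independent centered Gaussian variables of variances `r / 2` and
`ħ / 2`. -/
def complexGaussian (s ħ : ℝ) : Measure ℂ :=
  ((gaussianReal 0 ((2 * s - ħ) / 2).toNNReal).prod (gaussianReal 0 (ħ / 2).toNNReal)).map
    fun x => (x.1 : ℂ) + Complex.I * (x.2 : ℂ)

instance (s ħ : ℝ) : IsProbabilityMeasure (complexGaussian s ħ) :=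
  Measure.isProbabilityMeasure_map (by fun_prop)

/-- The measure `M_{s,ħ}` on the space of complexified connections. -/
def complexMeasure (ι : Type*) (s ħ : ℝ) : Measure (ComplexConnection ι) :=
  Measure.infinitePi fun _ => complexGaussian s ħ

lemma memLp_coord {ι : Type*} (s : ℝ) (i : ι) :
    MemLp (fun A : Connection ι => A i) 2 (realMeasure ι s) := by
  have h := measurePreserving_eval_infinitePi
    (fun _ : ι => gaussianReal 0 s.toNNReal) i
  exact (memLp_id_gaussianReal' 2 (by simp)).comp_measurePreserving h

lemma memLp_id_complexGaussian (s ħ : ℝ) : MemLp id 2 (complexGaussian s ħ) := by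
  have hm : Measurable fun x : ℝ × ℝ => (x.1 : ℂ) + Complex.I * (x.2 : ℂ) := by fun_prop
  have h1 : MemLp (fun x : ℝ × ℝ => x.1) 2 ((gaussianReal 0 ((2 * s - ħ) / 2).toNNReal).prod
      (gaussianReal 0 (ħ / 2).toNNReal)) :=
    (memLp_id_gaussianReal' 2 (by simp)).comp_measurePreserving measurePreserving_fst
  have h2 : MemLp (fun x : ℝ × ℝ => x.2) 2 ((gaussianReal 0 ((2 * s - ħ) / 2).toNNReal).prod
      (gaussianReal 0 (ħ / 2).toNNReal)) :=
    (memLp_id_gaussianReal' 2 (by simp)).comp_measurePreserving measurePreserving_snd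
  refine (memLp_map_measure_iff aestronglyMeasurable_id hm.aemeasurable).2 ?_
  have h3 := h1.ofReal (K := ℂ)
  have h4 := (h2.ofReal (K := ℂ)).const_mul Complex.I
  exact h3.add h4

lemma memLp_complexCoord {ι : Type*} (s ħ : ℝ) (i : ι) :
    MemLp (fun Z : ComplexConnection ι => Z i) 2 (complexMeasure ι s ħ) := by
  have h := measurePreserving_eval_infinitePi (fun _ : ι => complexGaussian s ħ) i
  exact (memLp_id_complexGaussian s ħ).comp_measurePreserving h

variable {𝔨 : Type*} [NormedAddCommGroup 𝔨] [InnerProductSpace ℝ 𝔨] {ι : Type*}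

/-- The random variable `A ↦ ⟨h, A⟩ = ∑ i, ⟨h, e i⟩ x i` attached to a direction
`h ∈ L2Connection 𝔨`; the series of multiples of the independent coordinates converges in
`L²(𝒜, P_s)`. -/
def pairing (b : HilbertBasis ι ℝ (L2Connection 𝔨)) (s : ℝ) (h : L2Connection 𝔨) :
    Lp ℝ 2 (realMeasure ι s) :=
  ∑' i, (b.repr h i) • (memLp_coord s i).toLp

/-- The complex linear extension `Z ↦ ⟨h, Z⟩ = ∑ i, ⟨h, e i⟩ z i` of `A ↦ ⟨h, A⟩` to complexified
connections, as an element of `L²(𝒜_ℂ, M_{s,ħ})`. -/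
def complexPairing (b : HilbertBasis ι ℝ (L2Connection 𝔨)) (s ħ : ℝ) (h : L2Connection 𝔨) :
    Lp ℂ 2 (complexMeasure ι s ħ) :=
  ∑' i, ((b.repr h i : ℝ) : ℂ) • (memLp_complexCoord s ħ i).toLp

/-- The function `A ↦ φ(⟨h₁, A⟩, …, ⟨hₙ, A⟩)` on the space of connections. -/
def cylinder (b : HilbertBasis ι ℝ (L2Connection 𝔨)) (s : ℝ) {n : ℕ} (h : Fin n → L2Connection 𝔨)
    (φ : (Fin n → ℝ) → ℂ) (A : Connection ι) : ℂ :=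
  φ fun k => pairing b s (h k) A

/-- The function `Z ↦ Φ(⟨h₁, Z⟩, …, ⟨hₙ, Z⟩)` on the space of complexified connections. -/
def complexCylinder (b : HilbertBasis ι ℝ (L2Connection 𝔨)) (s ħ : ℝ) {n : ℕ}
    (h : Fin n → L2Connection 𝔨) (Φ : (Fin n → ℂ) → ℂ) (Z : ComplexConnection ι) : ℂ :=
  Φ fun k => complexPairing b s ħ (h k) Z

/-- The cylinder functions in `L²(𝒜, P_s)`: those that depend only on the finitely many variables
`⟨h₁, A⟩, …, ⟨hₙ, A⟩`, for some finite orthonormal system `h₁, …, hₙ` of square-integrable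
connections. -/
def IsCylinder (b : HilbertBasis ι ℝ (L2Connection 𝔨)) (s : ℝ) (f : Lp ℂ 2 (realMeasure ι s)) : Prop :=
  ∃ (n : ℕ) (h : Fin n → L2Connection 𝔨) (φ : (Fin n → ℝ) → ℂ),
    Orthonormal ℝ h ∧ MemLp φ 2 (gaussian n s) ∧ f =ᵐ[realMeasure ι s] cylinder b s h φ

/-- The holomorphic cylinder functions in `L²(𝒜_ℂ, M_{s,ħ})`. -/
def IsHolomorphicCylinder (b : HilbertBasis ι ℝ (L2Connection 𝔨)) (s ħ : ℝ)
    (F : Lp ℂ 2 (complexMeasure ι s ħ)) : Prop :=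
  ∃ (n : ℕ) (h : Fin n → L2Connection 𝔨) (Φ : (Fin n → ℂ) → ℂ),
    Orthonormal ℝ h ∧ Differentiable ℂ Φ ∧ F =ᵐ[complexMeasure ι s ħ] complexCylinder b s ħ h Φ

/-- The holomorphic subspace `ℋL²(𝒜_ℂ, M_{s,ħ})`: the `L²` closure of the space of holomorphic
cylinder functions. -/
def HL2 (b : HilbertBasis ι ℝ (L2Connection 𝔨)) (s ħ : ℝ) : Submodule ℂ (Lp ℂ 2 (complexMeasure ι s ħ)) :=
  (Submodule.span ℂ {F | IsHolomorphicCylinder b s ħ F}).topologicalClosure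

/-! ### The Segal-Bargmann transform of cylinder functions -/

/-- The heat kernel `(2πt)^{-n/2} e^{-(x-q)²/2t}` of `Δ/2` on `ℝⁿ`. -/
def heatKernel {n : ℕ} (t : ℝ) (x q : Fin n → ℝ) : ℝ :=
  (2 * Real.pi * t) ^ (-(n : ℝ) / 2) * Real.exp (-(∑ k, (x k - q k) ^ 2) / (2 * t))

/-- `e^{tΔ/2} φ`: the solution at time `t` of the heat equation `∂u/∂t = Δu/2` on `ℝⁿ` with initial
condition `φ`. -/
def heat {n : ℕ} (t : ℝ) (φ : (Fin n → ℝ) → ℂ) (x : Fin n → ℝ) : ℂ :=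
  ∫ q, (heatKernel t x q : ℂ) * φ q

/-- `Φ` is an analytic continuation of `u` from `ℝⁿ` to `ℂⁿ`. -/
def IsAnalyticContinuation {n : ℕ} (u : (Fin n → ℝ) → ℂ) (Φ : (Fin n → ℂ) → ℂ) : Prop :=
  Differentiable ℂ Φ ∧ ∀ x : Fin n → ℝ, Φ (fun k => (x k : ℂ)) = u x

/-- `F` is the analytic continuation of `e^{ħΔ_𝒜/2} f`, for a cylinder function `f` in
`L²(𝒜, P_s)`. On functions of `⟨h₁, A⟩, …, ⟨hₙ, A⟩`, with `h₁, …, hₙ` orthonormal, the operator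
`Δ_𝒜` is the Laplacian in these `n` variables. -/
def IsTransform (b : HilbertBasis ι ℝ (L2Connection 𝔨)) (s ħ : ℝ)
    (f : Lp ℂ 2 (realMeasure ι s)) (F : Lp ℂ 2 (complexMeasure ι s ħ)) : Prop :=
  ∃ (n : ℕ) (h : Fin n → L2Connection 𝔨) (φ : (Fin n → ℝ) → ℂ) (Φ : (Fin n → ℂ) → ℂ),
    Orthonormal ℝ h ∧ MemLp φ 2 (gaussian n s) ∧ f =ᵐ[realMeasure ι s] cylinder b s h φ ∧
      IsAnalyticContinuation (heat ħ φ) Φ ∧ F =ᵐ[complexMeasure ι s ħ] complexCylinder b s ħ h Φ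

end SegalBargmann

end

open SegalBargmann

noncomputable section

namespace SegalBargmann

/-! ### Laws of series of independent coordinates -/

section

/-! The transform is determined by the characters `e^{i⟨c,A⟩}`, which are total in `L²(P_s)`. The
heat operator multiplies such a character by `e^{-ħ‖c‖²/2}`, and continuation replaces `A` by `Z`.
The inner product of the characters of `c` and `d` is `e^{-s‖d-c‖²/2}`. Their transforms have the
inner product `exp(-ħ(‖c‖²+‖d‖²)/2 - r‖d-c‖²/4 + ħ‖d+c‖²/4)`, and this is the same number by the
parallelogram law and `r + ħ = 2s`. Two families with equal Gram matrices, the first of them total,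
give a linear isometry `U` (`exists_linearIsometry_of_inner_eq`).

Cylinder functions reduce to finite dimension because the pairings with an orthonormal system have
the standard product laws (`map_series_eq_pi`). That `U` agrees with the continued heat operator on
every cylinder function follows by approximation: evaluation of the continuation at a point is a
bounded functional on `L²`, since the heat kernel divided by the Gaussian density is square
integrable when `s > ħ/2`. As `U` does not refer to any representation, independence of the
representation and both isometry statements follow.

For surjectivity, a holomorphic cylinder function in `n` variables is projected onto the closed
range of the `n`-variable transform. The remainder is again entire in these variables, and it is
orthogonal to the coherent states, which are multiples of transforms of Gaussians. Integration
against a coherent state is evaluation at a point up to nonzero factors: a translation followed by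
the circle mean value property shows it (`eq_zero_of_integral_reproducing_eq_zero`). So the
remainder vanishes, and the closed range of `U` is the whole holomorphic space. -/

lemma continuous_integral_cexp_mul_I {Ω : Type*} [MeasurableSpace Ω] (P : Measure Ω)
    [IsProbabilityMeasure P] :
    Continuous fun Y : Lp ℝ 2 P => ∫ a, Complex.exp ((Y a : ℂ) * Complex.I) ∂P := by
  have hi : ∀ Y : Lp ℝ 2 P, Integrable (fun a => Complex.exp ((Y a : ℂ) * Complex.I)) P := by
    intro Y
    refine (integrable_const (1 : ℝ)).mono' ?_ (.of_forall fun a => ?_)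
    · exact Complex.continuous_exp.comp_aestronglyMeasurable
        ((Complex.continuous_ofReal.comp_aestronglyMeasurable
          (Lp.aestronglyMeasurable Y)).mul_const _)
    · rw [Complex.norm_exp_ofReal_mul_I]
  refine LipschitzWith.continuous (K := 1) (LipschitzWith.of_dist_le_mul fun X Y => ?_)
  rw [dist_eq_norm, dist_eq_norm, ← integral_sub (hi X) (hi Y), NNReal.coe_one, one_mul]
  have hm : MemLp (X - Y : Lp ℝ 2 P) 1 P := (Lp.memLp (X - Y)).mono_exponent (by norm_num)
  calc ‖∫ a, Complex.exp ((X a : ℂ) * Complex.I) - Complex.exp ((Y a : ℂ) * Complex.I) ∂P‖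
      ≤ ∫ a, ‖(X - Y : Lp ℝ 2 P) a‖ ∂P := by
        refine norm_integral_le_of_norm_le (memLp_one_iff_integrable.1 hm).norm ?_
        filter_upwards [Lp.coeFn_sub X Y] with a ha
        have := Real.norm_exp_I_mul_ofReal_sub_one_le (x := X a - Y a)
        have h2 : Complex.exp ((X a : ℂ) * Complex.I) - Complex.exp ((Y a : ℂ) * Complex.I)
            = Complex.exp ((Y a : ℂ) * Complex.I) *
              (Complex.exp (Complex.I * ((X a - Y a : ℝ) : ℂ)) - 1) := by
          rw [mul_sub, ← Complex.exp_add, mul_one]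
          push_cast
          ring_nf
        rw [h2, norm_mul, Complex.norm_exp_ofReal_mul_I, one_mul, ha]
        exact this
    _ = (eLpNorm (X - Y : Lp ℝ 2 P) 1 P).toReal := by
        rw [eLpNorm_one_eq_lintegral_enorm,
          integral_norm_eq_lintegral_enorm hm.aestronglyMeasurable]
    _ ≤ ‖X - Y‖ := by
        rw [Lp.norm_def]
        refine ENNReal.toReal_mono (Lp.eLpNorm_ne_top _) ?_
        exact eLpNorm_le_eLpNorm_of_exponent_le (by norm_num) (Lp.aestronglyMeasurable _)

/-- Here `B` plays the role of half the covariance form of one coordinate. Orthonormality of the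
coefficient families removes the cross terms, so the exponents of the characteristic functions add
up to that of independent copies. -/
lemma hasSum_bilin_of_orthonormal {E ι : Type*} [NormedAddCommGroup E] [NormedSpace ℝ E] {n : ℕ}
    {c : Fin n → ι → ℝ} {B : StrongDual ℝ E →ₗ[ℝ] StrongDual ℝ E →ₗ[ℝ] ℝ}
    (hc : ∀ k l, HasSum (fun i => c k i * c l i) (if k = l then 1 else 0))
    (l : Fin n → StrongDual ℝ E) :
    HasSum (fun i => B (∑ k, c k i • l k) (∑ k, c k i • l k)) (∑ k, B (l k) (l k)) := by
  have h1 : ∀ i, B (∑ k, c k i • l k) (∑ k, c k i • l k)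
      = ∑ k, ∑ m, c k i * c m i * B (l k) (l m) := fun i => by
    simp [map_sum, LinearMap.sum_apply, Finset.mul_sum, mul_assoc]
    rw [Finset.sum_comm]
    refine Finset.sum_congr rfl fun k _ => Finset.sum_congr rfl fun m _ => by ring
  simp_rw [h1]
  have h2 : ∑ k, B (l k) (l k) = ∑ k, ∑ m, (if k = m then 1 else 0) * B (l k) (l m) := by simp
  rw [h2]
  exact hasSum_sum fun k _ => hasSum_sum fun m _ => (hc k m).mul_right _

section Series

variable {E : Type*} [NormedAddCommGroup E] [MeasurableSpace E] {ν : Measure E}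
  [IsProbabilityMeasure ν] {ι : Type*}

lemma memLp_eval (hν : MemLp id 2 ν) (i : ι) :
    MemLp (fun A : ι → E => A i) 2 (Measure.infinitePi fun _ : ι => ν) :=
  hν.comp_measurePreserving (measurePreserving_eval_infinitePi (fun _ : ι => ν) i)

/-- The `i`-th coordinate as an element of `L²` of a product measure. -/
def evalLp (hν : MemLp id 2 ν) (i : ι) : Lp E 2 (Measure.infinitePi fun _ : ι => ν) :=
  (memLp_eval hν i).toLp

lemma norm_evalLp (hν : MemLp id 2 ν) (i : ι) :
    ‖(evalLp hν i : Lp E 2 (Measure.infinitePi fun _ : ι => ν))‖ = (eLpNorm id 2 ν).toReal := by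
  rw [evalLp, Lp.norm_toLp]
  congr 1
  exact eLpNorm_comp_measurePreserving (g := id) hν.aestronglyMeasurable
    (measurePreserving_eval_infinitePi (fun _ : ι => ν) i)

variable [InnerProductSpace ℝ E] [CompleteSpace E] [SecondCountableTopology E] [BorelSpace E]

lemma inner_evalLp (hν : MemLp id 2 ν) (h0 : ∫ x, x ∂ν = 0) {i j : ι} (hij : i ≠ j) :
    inner ℝ (evalLp hν i : Lp E 2 (Measure.infinitePi fun _ : ι => ν)) (evalLp hν j) = 0 := by
  rw [L2.inner_def]
  have h1 : ∫ A : ι → E, inner ℝ (A i) (A j) ∂(Measure.infinitePi fun _ : ι => ν) = 0 := by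
    have h2 := Measure.infinitePi_map_eval_prod (P := fun _ : ι => ν) hij
    have h3 : ∫ A : ι → E, inner ℝ (A i) (A j) ∂(Measure.infinitePi fun _ : ι => ν)
        = ∫ p : E × E, inner ℝ p.1 p.2 ∂(ν.prod ν) := by
      rw [← h2, integral_map (by fun_prop) (by fun_prop)]
    rw [h3]
    -- If the inner product were not integrable, its Bochner integral would be 0 by convention,
    -- which is also the wanted value.
    by_cases hI : Integrable (fun p : E × E => (inner ℝ p.1 p.2 : ℝ)) (ν.prod ν)
    · rw [integral_prod _ hI]
      have : ∀ x : E, ∫ y, (inner ℝ x y : ℝ) ∂ν = 0 := fun x => by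
        rw [integral_inner (f := fun y : E => y) (hν.integrable (by norm_num)) x, h0, inner_zero_right]
      simp [this]
    · exact integral_undef hI
  rw [← h1]
  refine integral_congr_ae ?_
  filter_upwards [(memLp_eval hν i).coeFn_toLp, (memLp_eval hν j).coeFn_toLp] with A hi hj
  rw [evalLp, evalLp, hi, hj]

lemma summable_smul_evalLp (hν : MemLp id 2 ν) (h0 : ∫ x, x ∂ν = 0) {c : ι → ℝ}
    (hc : Summable fun i => c i * c i) :
    Summable fun i => c i • (evalLp hν i : Lp E 2 (Measure.infinitePi fun _ : ι => ν)) := by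
  let v : ι → Lp E 2 (Measure.infinitePi fun _ : ι => ν) := evalLp hν
  have hV : OrthogonalFamily ℝ (fun i => ↥(Submodule.span ℝ {v i}))
      fun i => (Submodule.span ℝ {v i}).subtypeₗᵢ := by
    intro i j hij x y
    obtain ⟨a, ha⟩ := Submodule.mem_span_singleton.1 x.2
    obtain ⟨b, hb⟩ := Submodule.mem_span_singleton.1 y.2
    change inner ℝ (x : Lp E 2 (Measure.infinitePi fun _ : ι => ν))
      (y : Lp E 2 (Measure.infinitePi fun _ : ι => ν)) = 0
    rw [← ha, ← hb, inner_smul_left, inner_smul_right, inner_evalLp hν h0 hij]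
    simp
  have := (hV.summable_iff_norm_sq_summable
    (fun i => ⟨c i • v i, Submodule.smul_mem _ _ (Submodule.mem_span_singleton_self _)⟩)).2 ?_
  · exact this
  · have h4 : ∀ i, ‖c i • v i‖ ^ 2 = c i * c i * (eLpNorm id 2 ν).toReal ^ 2 := fun i => by
      rw [norm_smul, mul_pow, norm_evalLp, Real.norm_eq_abs, sq_abs, sq]
    change Summable fun i => ‖c i • v i‖ ^ 2
    simp_rw [h4]
    exact hc.mul_right _

/-- Characteristic functions of finite partial sums are products by independence, and their
exponents converge by `hasSum_bilin_of_orthonormal`. Convergence in `L²` carries this to the limit.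
The form `B` lives on the real dual because on `ℂ` the two real directions have different variances.
-/
theorem map_series_eq_pi {n : ℕ} {c : Fin n → ι → ℝ}
    {B : StrongDual ℝ E →ₗ[ℝ] StrongDual ℝ E →ₗ[ℝ] ℝ} (hν : MemLp id 2 ν)
    (hB : ∀ L, charFunDual ν L = Complex.exp (-(B L L : ℂ)))
    (hc : ∀ k l, HasSum (fun i => c k i * c l i) (if k = l then 1 else 0))
    {ζ : Fin n → Lp E 2 (Measure.infinitePi fun _ : ι => ν)}
    (hζ : ∀ k, HasSum (fun i => c k i • evalLp hν i) (ζ k)) :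
    (Measure.infinitePi fun _ : ι => ν).map (fun A k => ζ k A) = Measure.pi fun _ => ν := by
  let P : Measure (ι → E) := Measure.infinitePi fun _ : ι => ν
  have hm : Measurable fun (A : ι → E) k => ζ k A :=
    measurable_pi_lambda _ fun k => (Lp.stronglyMeasurable (ζ k)).measurable
  have : IsProbabilityMeasure (P.map fun A k => ζ k A) :=
    Measure.isProbabilityMeasure_map hm.aemeasurable
  refine Measure.ext_of_charFunDual (funext fun L => ?_)
  let l : Fin n → StrongDual ℝ E := fun k => L.comp (.single ℝ (fun _ : Fin n => E) k)
  have hL : ∀ x, L x = ∑ k, l k (x k) := fun x =>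
    (ContinuousLinearMap.sum_comp_single (L := L) (v := x)).symm
  let Y : Lp ℝ 2 P := ∑ k, (l k).compLpL 2 P (ζ k)
  let S : Finset ι → Lp ℝ 2 P := fun F => ∑ k, (l k).compLpL 2 P (∑ i ∈ F, c k i • evalLp hν i)
  have hS : Filter.Tendsto S Filter.atTop (nhds Y) :=
    tendsto_finsetSum _ fun k _ => (((l k).compLpL 2 P).continuous.tendsto _).comp (hζ k)
  have h1 := ((continuous_integral_cexp_mul_I P).tendsto Y).comp hS
  have hY : ∀ᵐ A ∂P, (Y : (ι → E) → ℝ) A = L fun k => ζ k A := by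
    have h2 : ∀ᵐ A ∂P, ∀ k, ((l k).compLpL 2 P (ζ k) : (ι → E) → ℝ) A = l k (ζ k A) :=
      ae_all_iff.2 fun k => (l k).coeFn_compLp (ζ k)
    filter_upwards [h2, Lp.coeFn_finsetSum Finset.univ fun k => (l k).compLpL 2 P (ζ k)]
      with A hA hs
    rw [hL, hs, Finset.sum_apply]
    exact Finset.sum_congr rfl fun k _ => hA k
  have hSF : ∀ F, ∀ᵐ A ∂P, (S F : (ι → E) → ℝ) A
      = ∑ i ∈ F, (∑ k, c k i • l k) (A i) := by
    intro F
    have h2 : ∀ᵐ A ∂P, ∀ k, ((l k).compLpL 2 P (∑ i ∈ F, c k i • evalLp hν i) : (ι → E) → ℝ) A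
        = l k ((∑ i ∈ F, c k i • evalLp hν i : Lp E 2 P) A) :=
      ae_all_iff.2 fun k => (l k).coeFn_compLp _
    have h3 : ∀ᵐ A ∂P, ∀ k, (∑ i ∈ F, c k i • evalLp hν i : Lp E 2 P) A
        = ∑ i ∈ F, (c k i • evalLp hν i : Lp E 2 P) A :=
      ae_all_iff.2 fun k => by
        filter_upwards [Lp.coeFn_finsetSum F fun i => c k i • evalLp hν i] with A hA
        rw [hA, Finset.sum_apply]
    have h4 : ∀ᵐ A ∂P, ∀ i ∈ F, ∀ k, (c k i • evalLp hν i : Lp E 2 P) A = c k i • A i := by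
      refine (ae_ball_iff F.countable_toSet).2 fun i _ => ae_all_iff.2 fun k => ?_
      filter_upwards [Lp.coeFn_smul (c k i) (evalLp hν i : Lp E 2 P),
        (memLp_eval hν i).coeFn_toLp] with A hA hA'
      rw [hA, Pi.smul_apply, evalLp, hA']
    filter_upwards [h2, h3, h4, Lp.coeFn_finsetSum Finset.univ
      fun k => (l k).compLpL 2 P (∑ i ∈ F, c k i • evalLp hν i)] with A hA2 hA3 hA4 hA5
    rw [hA5, Finset.sum_apply]
    simp_rw [hA2, hA3, map_sum]
    rw [Finset.sum_comm]
    refine Finset.sum_congr rfl fun i hi => ?_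
    simp [hA4 i hi]
  have hval : ∀ F, ∫ A, Complex.exp ((S F A : ℂ) * Complex.I) ∂P
      = Complex.exp (-((∑ i ∈ F, B (∑ k, c k i • l k) (∑ k, c k i • l k) : ℝ) : ℂ)) := by
    intro F
    let M : ι → StrongDual ℝ E := fun i => ∑ k, c k i • l k
    let X : ι → (ι → E) → ℝ := fun i A => M i (A i)
    have hX : ∀ i, Measurable (X i) := fun i => by fun_prop
    have hind : iIndepFun X P :=
      iIndepFun_infinitePi (P := fun _ : ι => ν) (X := fun i => M i) (fun i => by fun_prop)
    have h5 := iIndepFun.charFun_map_finsetSum_eq_prod (s := F) (X := X) (P := P)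
      (fun i _ => (hX i).aemeasurable) (hind.restrict _)
    have h6 := congrFun h5 1
    have h7 : ∀ i, charFun (P.map (X i)) 1 = Complex.exp (-(B (M i) (M i) : ℂ)) := fun i => by
      rw [← hB, charFun_apply, charFunDual_apply, integral_map (hX i).aemeasurable (by fun_prop)]
      have := (measurePreserving_eval_infinitePi (fun _ : ι => ν) i).map_eq
      rw [← this, integral_map (measurable_pi_apply i).aemeasurable (by fun_prop)]
      simp [X, P]
    rw [Finset.prod_apply, Finset.prod_congr rfl fun i _ => h7 i, ← Complex.exp_sum, charFun_apply,
      integral_map (Finset.aemeasurable_sum _ fun i _ => (hX i).aemeasurable) (by fun_prop)] at h6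
    push_cast
    rw [← Finset.sum_neg_distrib, ← h6]
    refine integral_congr_ae ?_
    filter_upwards [hSF F] with A hA
    simp [hA, X, M, Finset.sum_apply]
  have h8 : Filter.Tendsto (fun F : Finset ι => Complex.exp
      (-((∑ i ∈ F, B (∑ k, c k i • l k) (∑ k, c k i • l k) : ℝ) : ℂ))) Filter.atTop
      (nhds (Complex.exp (-((∑ k, B (l k) (l k) : ℝ) : ℂ)))) :=
    (Continuous.tendsto (f := fun x : ℝ => Complex.exp (-(x : ℂ))) (by fun_prop) _).comp
      (hasSum_bilin_of_orthonormal hc l)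
  have h9 := tendsto_nhds_unique (h1.congr hval) h8
  rw [charFunDual_pi, charFunDual_apply, integral_map hm.aemeasurable (by fun_prop)]
  simp_rw [hB, ← Complex.exp_sum]
  rw [Finset.sum_neg_distrib, ← Complex.ofReal_sum, ← h9]
  refine integral_congr_ae ?_
  filter_upwards [hY] with A hA
  rw [hA]

end Series

end

/-! ### The pairings -/

section

lemma charFunDual_gaussianReal_zero (v : ℝ≥0) (L : StrongDual ℝ ℝ) :
    charFunDual (gaussianReal 0 v) L = Complex.exp (-((v / 2 * (L 1 * L 1) : ℝ) : ℂ)) := by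
  have h : charFunDual (gaussianReal 0 v) L = charFun (gaussianReal 0 v) (L 1) := by
    rw [charFunDual_apply, charFun_apply]
    have : ∀ x : ℝ, L x = inner ℝ x (L 1) := fun x => by
      have := L.map_smul x 1
      simpa [mul_comm] using this
    exact integral_congr_ae (.of_forall fun x => by simp only; rw [this x])
  rw [h, charFun_gaussianReal]
  congr 1
  push_cast
  ring

lemma charFunDual_complexGaussian (s ħ : ℝ) (L : StrongDual ℝ ℂ) :
    charFunDual (complexGaussian s ħ) L = Complex.exp (-((((2 * s - ħ) / 2).toNNReal / 2 *
      (L 1 * L 1) + (ħ / 2).toNNReal / 2 * (L Complex.I * L Complex.I) : ℝ) : ℂ)) := by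
  have hL : ∀ x : ℝ × ℝ, L ((x.1 : ℂ) + Complex.I * (x.2 : ℂ)) = x.1 * L 1 + x.2 * L Complex.I := by
    intro x
    have h1 : ((x.1 : ℂ) + Complex.I * (x.2 : ℂ)) = x.1 • (1 : ℂ) + x.2 • Complex.I := by
      simp [mul_comm]
    rw [h1, map_add, map_smul, map_smul, smul_eq_mul, smul_eq_mul]
  rw [charFunDual_apply, complexGaussian, integral_map (by fun_prop) (by fun_prop)]
  simp_rw [hL]
  have h2 : ∀ x : ℝ × ℝ, Complex.exp (((x.1 * L 1 + x.2 * L Complex.I : ℝ) : ℂ) * Complex.I)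
      = Complex.exp (L 1 * x.1 * Complex.I) * Complex.exp (L Complex.I * x.2 * Complex.I) := by
    intro x
    rw [← Complex.exp_add]
    push_cast
    ring_nf
  simp_rw [h2]
  rw [integral_prod_mul (f := fun x : ℝ => Complex.exp (L 1 * x * Complex.I))
    (g := fun x : ℝ => Complex.exp (L Complex.I * x * Complex.I)),
    ← charFun_apply_real, ← charFun_apply_real, charFun_gaussianReal, charFun_gaussianReal,
    ← Complex.exp_add]
  congr 1
  push_cast
  ring

lemma integral_id_complexGaussian (s ħ : ℝ) : ∫ z, z ∂complexGaussian s ħ = 0 := by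
  rw [complexGaussian, integral_map (by fun_prop) (by fun_prop)]
  have h1 : Integrable (fun x : ℝ × ℝ => (x.1 : ℂ)) ((gaussianReal 0 ((2 * s - ħ) / 2).toNNReal).prod
      (gaussianReal 0 (ħ / 2).toNNReal)) :=
    (((memLp_id_gaussianReal' 1 (by simp)).comp_measurePreserving
      measurePreserving_fst).integrable le_rfl).ofReal
  have h2 : Integrable (fun x : ℝ × ℝ => (x.2 : ℂ)) ((gaussianReal 0 ((2 * s - ħ) / 2).toNNReal).prod
      (gaussianReal 0 (ħ / 2).toNNReal)) :=
    (((memLp_id_gaussianReal' 1 (by simp)).comp_measurePreserving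
      measurePreserving_snd).integrable le_rfl).ofReal
  rw [integral_add h1 (h2.const_mul _), integral_const_mul, integral_prod _ h1, integral_prod _ h2]
  have h3 : ∀ v, ∫ x, (x : ℂ) ∂gaussianReal 0 v = 0 := fun v => by
    rw [integral_complex_ofReal, integral_id_gaussianReal, Complex.ofReal_zero]
  simp [h3]

variable {𝔨 : Type*} [NormedAddCommGroup 𝔨] [InnerProductSpace ℝ 𝔨] {ι : Type*}
  (b : HilbertBasis ι ℝ (L2Connection 𝔨)) {s ħ : ℝ}

lemma hasSum_repr_mul_repr (x y : L2Connection 𝔨) :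
    HasSum (fun i => b.repr x i * b.repr y i) (inner ℝ x y) := by
  have h := lp.hasSum_inner (𝕜 := ℝ) (G := fun _ : ι => ℝ) (b.repr x) (b.repr y)
  rw [b.repr.inner_map_map] at h
  simpa [mul_comm] using h

lemma hasSum_repr_mul_repr_of_orthonormal {n : ℕ} {h : Fin n → L2Connection 𝔨}
    (hh : Orthonormal ℝ h) (k l : Fin n) :
    HasSum (fun i => b.repr (h k) i * b.repr (h l) i) (if k = l then 1 else 0) := by
  rw [← orthonormal_iff_ite.1 hh k l]
  exact hasSum_repr_mul_repr b _ _

/-- A divergent `tsum` has the default value 0; convergence of this orthogonal series shows that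
`pairing` is the intended limit. -/
lemma hasSum_pairing (h : L2Connection 𝔨) :
    HasSum (fun i => (b.repr h i) • (memLp_coord s i).toLp) (pairing b s h) :=
  (summable_smul_evalLp (memLp_id_gaussianReal' 2 (by simp)) (by simp)
    (hasSum_repr_mul_repr b h h).summable).hasSum

lemma ofReal_smul_Lp {α : Type*} {m : MeasurableSpace α} {μ : Measure α} (c : ℝ) (f : Lp ℂ 2 μ) :
    (c : ℂ) • f = c • f := by
  refine Lp.ext ?_
  filter_upwards [Lp.coeFn_smul (c : ℂ) f, Lp.coeFn_smul c f] with a h1 h2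
  rw [h1, h2, Pi.smul_apply, Pi.smul_apply, smul_eq_mul, Complex.real_smul]

lemma hasSum_complexPairing_real (h : L2Connection 𝔨) :
    HasSum (fun i => (b.repr h i) • (memLp_complexCoord s ħ i).toLp) (complexPairing b s ħ h) := by
  rw [complexPairing]
  simp_rw [ofReal_smul_Lp]
  exact (summable_smul_evalLp (memLp_id_complexGaussian s ħ) (integral_id_complexGaussian s ħ)
    (hasSum_repr_mul_repr b h h).summable).hasSum

lemma pairing_sum {κ : Type*} [Fintype κ] (t : κ → ℝ) (h : κ → L2Connection 𝔨) :
    pairing b s (∑ k, t k • h k) = ∑ k, t k • pairing b s (h k) := by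
  refine (hasSum_pairing b _).unique ?_
  have h1 : HasSum (fun i => ∑ k, t k • ((b.repr (h k) i) • (memLp_coord s i).toLp))
      (∑ k, t k • pairing b s (h k)) :=
    hasSum_sum fun k _ => (hasSum_pairing b (h k)).const_smul (t k)
  convert h1 using 2 with i
  simp_rw [b.repr_apply_apply, inner_sum, inner_smul_right, Finset.sum_smul, mul_smul]

lemma complexPairing_sum {κ : Type*} [Fintype κ] (t : κ → ℝ) (h : κ → L2Connection 𝔨) :
    complexPairing b s ħ (∑ k, t k • h k) = ∑ k, t k • complexPairing b s ħ (h k) := by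
  refine (hasSum_complexPairing_real b _).unique ?_
  have h1 : HasSum (fun i => ∑ k, t k • ((b.repr (h k) i) • (memLp_complexCoord s ħ i).toLp))
      (∑ k, t k • complexPairing b s ħ (h k)) :=
    hasSum_sum fun k _ => (hasSum_complexPairing_real b (h k)).const_smul (t k)
  convert h1 using 2 with i
  simp_rw [b.repr_apply_apply, inner_sum, inner_smul_right, Finset.sum_smul, mul_smul]

lemma coeFn_pairing_sum {κ : Type*} [Fintype κ] (t : κ → ℝ) (h : κ → L2Connection 𝔨) :
    ∀ᵐ A ∂realMeasure ι s, pairing b s (∑ k, t k • h k) A = ∑ k, t k * pairing b s (h k) A := by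
  have h1 : ∀ᵐ A ∂realMeasure ι s, ∀ k, (t k • pairing b s (h k) : Lp ℝ 2 (realMeasure ι s)) A
      = t k * pairing b s (h k) A :=
    ae_all_iff.2 fun k => Lp.coeFn_smul (t k) (pairing b s (h k))
  filter_upwards [h1, Lp.coeFn_finsetSum Finset.univ fun k => t k • pairing b s (h k)] with A h1 h2
  rw [pairing_sum, h2, Finset.sum_apply]
  exact Finset.sum_congr rfl fun k _ => h1 k

lemma coeFn_complexPairing_sum {κ : Type*} [Fintype κ] (t : κ → ℝ) (h : κ → L2Connection 𝔨) :
    ∀ᵐ Z ∂complexMeasure ι s ħ,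
      complexPairing b s ħ (∑ k, t k • h k) Z = ∑ k, (t k : ℂ) * complexPairing b s ħ (h k) Z := by
  have h1 : ∀ᵐ Z ∂complexMeasure ι s ħ, ∀ k,
      (t k • complexPairing b s ħ (h k) : Lp ℂ 2 (complexMeasure ι s ħ)) Z
        = t k * complexPairing b s ħ (h k) Z :=
    ae_all_iff.2 fun k => by
      filter_upwards [Lp.coeFn_smul (t k) (complexPairing b s ħ (h k))] with Z hZ
      rw [hZ, Pi.smul_apply, Complex.real_smul]
  filter_upwards [h1, Lp.coeFn_finsetSum Finset.univ fun k => t k • complexPairing b s ħ (h k)]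
    with Z h1 h2
  rw [complexPairing_sum, h2, Finset.sum_apply]
  exact Finset.sum_congr rfl fun k _ => h1 k

lemma pairing_basis (i : ι) : pairing b s (b i) = (memLp_coord s i).toLp := by
  classical
  refine (hasSum_pairing b _).unique ?_
  convert hasSum_single (f := fun j => b.repr (b i) j • (memLp_coord (ι := ι) s j).toLp) i ?_ using 1
  · simp [b.repr_self]
  · intro j hj
    simp [b.repr_self, lp.single_apply, hj]

theorem measurePreserving_pairing {n : ℕ} {h : Fin n → L2Connection 𝔨} (hh : Orthonormal ℝ h) :
    MeasurePreserving (fun A k => pairing b s (h k) A) (realMeasure ι s) (gaussian n s) := by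
  refine ⟨measurable_pi_lambda _ fun k => (Lp.stronglyMeasurable _).measurable, ?_⟩
  let e : StrongDual ℝ ℝ →ₗ[ℝ] ℝ := (ContinuousLinearMap.apply ℝ ℝ (1 : ℝ)).toLinearMap
  exact map_series_eq_pi (B := ((s.toNNReal / 2 : ℝ)) • (LinearMap.mul ℝ ℝ).compl₁₂ e e)
    (memLp_id_gaussianReal' 2 (by simp)) (charFunDual_gaussianReal_zero _)
    (hasSum_repr_mul_repr_of_orthonormal b hh) fun k => hasSum_pairing b (h k)

theorem measurePreserving_complexPairing {n : ℕ} {h : Fin n → L2Connection 𝔨}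
    (hh : Orthonormal ℝ h) :
    MeasurePreserving (fun Z k => complexPairing b s ħ (h k) Z) (complexMeasure ι s ħ)
      (Measure.pi fun _ => complexGaussian s ħ) := by
  refine ⟨measurable_pi_lambda _ fun k => (Lp.stronglyMeasurable _).measurable, ?_⟩
  let e (z : ℂ) : StrongDual ℝ ℂ →ₗ[ℝ] ℝ := (ContinuousLinearMap.apply ℝ ℝ z).toLinearMap
  exact map_series_eq_pi
    (B := ((((2 * s - ħ) / 2).toNNReal / 2 : ℝ)) • (LinearMap.mul ℝ ℝ).compl₁₂ (e 1) (e 1)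
      + (((ħ / 2).toNNReal / 2 : ℝ)) • (LinearMap.mul ℝ ℝ).compl₁₂ (e Complex.I) (e Complex.I))
    (memLp_id_complexGaussian s ħ) (charFunDual_complexGaussian s ħ)
    (hasSum_repr_mul_repr_of_orthonormal b hh) fun k => hasSum_complexPairing_real b (h k)

end

/-! ### Totality of the characters -/

section

/-- The positive and negative parts of `g` are densities of two finite measures. The hypothesis
equates the characteristic functions of their finite-dimensional marginals, hence the marginals, and
a projective limit of finite measures is unique. So the two parts agree almost everywhere, which
forces both to vanish. -/
lemma ae_eq_zero_of_integral_character_mul_ofReal {ι : Type*} {μ : Measure (ι → ℝ)} [IsFiniteMeasure μ]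
    {g : (ι → ℝ) → ℝ} (hg : Integrable g μ)
    (h : ∀ (J : Finset ι) (t : J → ℝ),
      ∫ x, Complex.exp (Complex.I * ((∑ j, t j * x j : ℝ) : ℂ)) * (g x : ℂ) ∂μ = 0) :
    g =ᵐ[μ] 0 := by
  classical
  set μp := μ.withDensity fun x => ENNReal.ofReal (g x)
  set μm := μ.withDensity fun x => ENNReal.ofReal (-g x)
  have : IsFiniteMeasure μp := isFiniteMeasure_withDensity_ofReal hg.2
  have : IsFiniteMeasure μm := isFiniteMeasure_withDensity_ofReal hg.neg.2
  have hmp : AEMeasurable (fun x => ENNReal.ofReal (g x)) μ := hg.aemeasurable.ennreal_ofReal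
  have hmm : AEMeasurable (fun x => ENNReal.ofReal (-g x)) μ := hg.neg.aemeasurable.ennreal_ofReal
  have hfun : ∀ J : Finset ι, μp.map J.restrict = μm.map J.restrict := by
    intro J
    have hJ : Measurable (J.restrict : (ι → ℝ) → J → ℝ) := by fun_prop
    have : IsFiniteMeasure (μp.map J.restrict) := μp.isFiniteMeasure_map _
    have : IsFiniteMeasure (μm.map J.restrict) := μm.isFiniteMeasure_map _
    refine Measure.ext_of_charFunDual (funext fun L => ?_)
    rw [charFunDual_apply, charFunDual_apply, integral_map hJ.aemeasurable (by fun_prop),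
      integral_map hJ.aemeasurable (by fun_prop),
      integral_withDensity_eq_integral_toReal_smul₀ hmp (by simp),
      integral_withDensity_eq_integral_toReal_smul₀ hmm (by simp), ← sub_eq_zero]
    let F : (ι → ℝ) → ℂ := fun x => Complex.exp (L (J.restrict x) * Complex.I)
    have hF : AEStronglyMeasurable F μ := by
      have : Measurable F := by fun_prop
      exact this.aestronglyMeasurable
    have hFn : ∀ x, ‖F x‖ ≤ 1 := fun x => (Complex.norm_exp_ofReal_mul_I _).le
    have hi : ∀ k : (ι → ℝ) → ℝ, Integrable k μ →
        Integrable (fun x => (ENNReal.ofReal (k x)).toReal • F x) μ := by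
      intro k hk
      have hk' : Integrable (fun x => (ENNReal.ofReal (k x)).toReal) μ := by
        simpa [ENNReal.toReal_ofReal'] using! hk.pos_part
      exact hk'.smul_bdd 1 hF (.of_forall hFn)
    refine (integral_sub (hi g hg) (hi (fun x => -g x) hg.neg)).symm.trans ?_
    rw [← h J fun j => L (Pi.single j 1)]
    refine integral_congr_ae (.of_forall fun x => ?_)
    have hLx : L (J.restrict x) = ∑ j : J, L (Pi.single j 1) * x j := by
      refine (L.pi_apply_eq_sum_univ (J.restrict x)).trans ?_
      refine Finset.sum_congr rfl fun j _ => ?_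
      rw [smul_eq_mul, mul_comm]
      change L _ * x j = _
      congr 2
      ext k
      simp [Pi.single_apply, eq_comm]
    simp only [F]
    rw [hLx, ← sub_smul, ENNReal.toReal_ofReal', ENNReal.toReal_ofReal', Complex.real_smul,
      mul_comm, mul_comm Complex.I]
    congr 2
    rcases le_total 0 (g x) with h0 | h0
    · rw [max_eq_left h0, max_eq_right (by linarith), sub_zero]
    · rw [max_eq_right h0, max_eq_left (by linarith)]; ring
  have heq : μp = μm :=
    IsProjectiveLimit.unique (P := fun J => μm.map J.restrict) hfun fun _ => rfl
  have := (withDensity_eq_iff hmp hmm hg.lintegral_lt_top.ne).1 heq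
  filter_upwards [this] with x hx
  rcases le_total 0 (g x) with h0 | h0
  · rw [ENNReal.ofReal_of_nonpos (p := -g x) (by linarith), ENNReal.ofReal_eq_zero] at hx
    exact le_antisymm hx h0
  · rw [ENNReal.ofReal_of_nonpos h0, eq_comm, ENNReal.ofReal_eq_zero] at hx
    exact le_antisymm h0 (neg_nonpos.1 hx)

lemma integrable_character_mul {ι : Type*} {μ : Measure (ι → ℝ)} {f : (ι → ℝ) → ℂ}
    (hf : Integrable f μ) (J : Finset ι) (t : J → ℝ) :
    Integrable (fun x => Complex.exp (Complex.I * ((∑ j, t j * x j : ℝ) : ℂ)) * f x) μ := by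
  refine hf.bdd_mul (c := 1) ?_ (.of_forall fun x => ?_)
  · exact Measurable.aestronglyMeasurable (by fun_prop)
  · rw [Complex.norm_exp_I_mul_ofReal]

/-- Conjugating the hypothesis at `-t` gives it for the conjugate of `f`, hence for the real and
imaginary parts. -/
lemma ae_eq_zero_of_integral_character_mul {ι : Type*} {μ : Measure (ι → ℝ)} [IsFiniteMeasure μ]
    {f : (ι → ℝ) → ℂ} (hf : Integrable f μ)
    (h : ∀ (J : Finset ι) (t : J → ℝ),
      ∫ x, Complex.exp (Complex.I * ((∑ j, t j * x j : ℝ) : ℂ)) * f x ∂μ = 0) :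
    f =ᵐ[μ] 0 := by
  have hconj : ∀ (J : Finset ι) (t : J → ℝ),
      ∫ x, Complex.exp (Complex.I * ((∑ j, t j * x j : ℝ) : ℂ)) * starRingEnd ℂ (f x) ∂μ = 0 := by
    intro J t
    have h1 := congrArg (starRingEnd ℂ) (h J (-t))
    rw [← integral_conj, map_zero] at h1
    rw [← h1]
    refine integral_congr_ae (.of_forall fun x => ?_)
    simp [← Complex.exp_conj, Finset.sum_neg_distrib]
  have hfc : Integrable (fun x => starRingEnd ℂ (f x)) μ :=
    (LinearIsometryEquiv.integrable_comp_iff Complex.conjLIE).2 hf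
  have hre : (fun x => (f x).re) =ᵐ[μ] 0 := by
    refine ae_eq_zero_of_integral_character_mul_ofReal hf.re fun J t => ?_
    have h1 := congrArg₂ (· + ·) (h J t) (hconj J t)
    beta_reduce at h1
    rw [← integral_add (integrable_character_mul hf J t) (integrable_character_mul hfc J t)] at h1
    have h2 := congrArg (fun z => z / 2) h1
    beta_reduce at h2
    rw [← integral_div, add_zero, zero_div] at h2
    rw [← h2]
    refine integral_congr_ae (.of_forall fun x => ?_)
    simp only
    rw [← mul_add, Complex.add_conj]
    push_cast
    ring
  have him : (fun x => (f x).im) =ᵐ[μ] 0 := by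
    refine ae_eq_zero_of_integral_character_mul_ofReal hf.im fun J t => ?_
    have h1 := congrArg₂ (· - ·) (h J t) (hconj J t)
    beta_reduce at h1
    rw [← integral_sub (integrable_character_mul hf J t) (integrable_character_mul hfc J t)] at h1
    have h2 := congrArg (fun z => z / (2 * Complex.I)) h1
    beta_reduce at h2
    rw [← integral_div, sub_zero, zero_div] at h2
    rw [← h2]
    refine integral_congr_ae (.of_forall fun x => ?_)
    simp only
    rw [← mul_sub, Complex.sub_conj]
    have := Complex.I_ne_zero
    push_cast
    field_simp
  filter_upwards [hre, him] with x h1 h2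
  exact Complex.ext h1 h2

theorem topologicalClosure_span_eq_top_of_characters {ι : Type*} {μ : Measure (ι → ℝ)}
    [IsFiniteMeasure μ] {S : Set (Lp ℂ 2 μ)}
    (hS : ∀ (J : Finset ι) (t : J → ℝ), ∃ g ∈ S,
      g =ᵐ[μ] fun x => Complex.exp (Complex.I * ((∑ j, t j * x j : ℝ) : ℂ))) :
    (Submodule.span ℂ S).topologicalClosure = ⊤ := by
  rw [Submodule.topologicalClosure_eq_top_iff, Submodule.eq_bot_iff]
  intro f hf
  have h0 : f =ᵐ[μ] 0 := by
    refine ae_eq_zero_of_integral_character_mul ((Lp.memLp f).integrable (by norm_num))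
      fun J t => ?_
    obtain ⟨g, hgS, hg⟩ := hS J (-t)
    have h1 := (Submodule.mem_orthogonal _ _).1 hf g (Submodule.subset_span hgS)
    rw [L2.inner_def] at h1
    rw [← h1]
    refine integral_congr_ae ?_
    filter_upwards [hg] with x hx
    simp [hx, ← Complex.exp_conj, Finset.sum_neg_distrib, mul_comm]
  exact (Lp.eq_zero_iff_ae_eq_zero).2 h0

end

/-! ### Gaussian densities -/

section

lemma pi_withDensity_ofReal {α : Type*} [MeasurableSpace α] {μ : Measure α} [SigmaFinite μ] {n : ℕ}
    {ρ : α → ℝ} (h0 : ∀ x, 0 ≤ ρ x) (hi : Integrable ρ μ) :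
    (Measure.pi fun _ : Fin n => μ.withDensity fun x => ENNReal.ofReal (ρ x))
      = (Measure.pi fun _ => μ).withDensity fun x => ENNReal.ofReal (∏ k, ρ (x k)) := by
  have : IsFiniteMeasure (μ.withDensity fun x => ENNReal.ofReal (ρ x)) :=
    isFiniteMeasure_withDensity_ofReal hi.2
  refine Measure.pi_eq fun S hS => ?_
  rw [withDensity_apply _ (.univ_pi hS), Measure.restrict_pi_pi]
  have hS' : ∀ k, Integrable ρ (μ.restrict (S k)) := fun k => hi.restrict
  rw [← ofReal_integral_eq_lintegral_ofReal (Integrable.fintype_prod hS')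
    (.of_forall fun x => Finset.prod_nonneg fun k _ => h0 _), integral_fintype_prod_eq_prod,
    ENNReal.ofReal_prod_of_nonneg fun k _ => integral_nonneg h0]
  refine Finset.prod_congr rfl fun k _ => ?_
  rw [withDensity_apply _ (hS k), ofReal_integral_eq_lintegral_ofReal (hS' k) (.of_forall h0)]

/-- The density of `gaussian n s`. -/
def gaussianDensity {n : ℕ} (s : ℝ) (q : Fin n → ℝ) : ℝ :=
  (√(2 * Real.pi * s))⁻¹ ^ n * Real.exp (-(∑ k, q k ^ 2) / (2 * s))

lemma gaussianDensity_pos {n : ℕ} {s : ℝ} (hs : 0 < s) (q : Fin n → ℝ) :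
    0 < gaussianDensity s q := by
  have := Real.pi_pos
  unfold gaussianDensity
  positivity

lemma measurable_gaussianDensity {n : ℕ} (s : ℝ) :
    Measurable (gaussianDensity s : (Fin n → ℝ) → ℝ) := by
  unfold gaussianDensity
  fun_prop

lemma gaussian_eq_withDensity {n : ℕ} {s : ℝ} (hs : 0 < s) :
    gaussian n s = volume.withDensity fun q => ENNReal.ofReal (gaussianDensity s q) := by
  have hs' : s.toNNReal ≠ 0 := by simpa using hs
  have h1 : gaussian n s = Measure.pi fun _ : Fin n =>
      volume.withDensity fun x => ENNReal.ofReal (gaussianPDFReal 0 s.toNNReal x) := by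
    rw [gaussian, gaussianReal_of_var_ne_zero _ hs']
    rfl
  rw [h1, pi_withDensity_ofReal (gaussianPDFReal_nonneg _ _) (integrable_gaussianPDFReal _ _),
    volume_pi]
  congr 1
  ext q
  congr 1
  simp only [gaussianPDFReal, gaussianDensity, Finset.prod_mul_distrib, Finset.prod_const,
    Finset.card_univ, Fintype.card_fin, ← Real.exp_sum, sub_zero, Real.coe_toNNReal s hs.le]
  rw [← Finset.sum_div, Finset.sum_neg_distrib]

instance (n : ℕ) (s : ℝ) : IsProbabilityMeasure (gaussian n s) := by
  unfold gaussian
  infer_instance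

lemma integral_gaussian {n : ℕ} {s : ℝ} (hs : 0 < s) (f : (Fin n → ℝ) → ℂ) :
    ∫ q, f q ∂gaussian n s = ∫ q, (gaussianDensity s q : ℂ) * f q := by
  rw [gaussian_eq_withDensity hs, integral_withDensity_eq_integral_toReal_smul
    (measurable_gaussianDensity s).ennreal_ofReal (by simp)]
  refine integral_congr_ae (.of_forall fun q => ?_)
  simp only
  rw [ENNReal.toReal_ofReal (gaussianDensity_pos hs q).le, Complex.real_smul]

lemma integrable_gaussian_iff {n : ℕ} {s : ℝ} (hs : 0 < s) {f : (Fin n → ℝ) → ℂ} :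
    Integrable f (gaussian n s) ↔ Integrable fun q => (gaussianDensity s q : ℂ) * f q := by
  rw [gaussian_eq_withDensity hs, integrable_withDensity_iff_integrable_smul'
    (measurable_gaussianDensity s).ennreal_ofReal (by simp)]
  refine integrable_congr (.of_forall fun q => ?_)
  simp only
  rw [ENNReal.toReal_ofReal (gaussianDensity_pos hs q).le, Complex.real_smul]

/-- The function `q ↦ e^{-b q² + c·q}`. -/
def quadExp {n : ℕ} (b : ℝ) (c : Fin n → ℂ) (q : Fin n → ℝ) : ℂ :=
  Complex.exp (-(b : ℂ) * ∑ k, (q k : ℂ) ^ 2 + ∑ k, c k * q k)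

lemma continuous_quadExp {n : ℕ} (b : ℝ) (c : Fin n → ℂ) : Continuous (quadExp b c) := by
  unfold quadExp
  fun_prop

lemma norm_quadExp {n : ℕ} (b : ℝ) (c : Fin n → ℂ) (q : Fin n → ℝ) :
    ‖quadExp b c q‖ = Real.exp (-b * ∑ k, q k ^ 2 + ∑ k, (c k).re * q k) := by
  rw [quadExp, Complex.norm_exp]
  congr 1
  have h1 : (-(b : ℂ) * ∑ k, (q k : ℂ) ^ 2) = ((-b * ∑ k, q k ^ 2 : ℝ) : ℂ) := by push_cast; rfl
  rw [Complex.add_re, h1, Complex.ofReal_re, Complex.re_sum]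
  simp

lemma quadExp_mul_quadExp {n : ℕ} (b b' : ℝ) (c c' : Fin n → ℂ) (q : Fin n → ℝ) :
    quadExp b c q * quadExp b' c' q = quadExp (b + b') (c + c') q := by
  simp only [quadExp, ← Complex.exp_add]
  congr 1
  simp only [Pi.add_apply, add_mul, Finset.sum_add_distrib]
  push_cast
  ring

lemma gaussianDensity_mul_quadExp {n : ℕ} {s : ℝ} (b : ℝ) (c : Fin n → ℂ) (q : Fin n → ℝ) :
    (gaussianDensity s q : ℂ) * quadExp b c q
      = (((√(2 * Real.pi * s))⁻¹ ^ n : ℝ) : ℂ) * quadExp (b + 1 / (2 * s)) c q := by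
  rw [gaussianDensity, quadExp, quadExp]
  push_cast
  rw [mul_assoc, ← Complex.exp_add]
  congr 2
  ring

lemma integrable_quadExp {n : ℕ} {b : ℝ} (hb : 0 < b) (c : Fin n → ℂ) : Integrable (quadExp b c) :=
  GaussianFourier.integrable_cexp_neg_mul_sum_add (by simpa using hb) c

/-- The squared modulus has quadratic coefficient `2b` and the Gaussian density adds `1/(2s)`;
integrability needs the sum `2(b + 1/(4s))` to be positive. -/
lemma memLp_quadExp {n : ℕ} {s : ℝ} (hs : 0 < s) {b : ℝ} (hb : 0 < b + 1 / (4 * s))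
    (c : Fin n → ℂ) : MemLp (quadExp b c) 2 (gaussian n s) := by
  rw [memLp_two_iff_integrable_sq_norm (continuous_quadExp b c).aestronglyMeasurable]
  have h1 : Integrable (fun q : Fin n → ℝ => quadExp (2 * b) (fun k => ((2 * (c k).re : ℝ) : ℂ)) q)
      (gaussian n s) := by
    rw [integrable_gaussian_iff hs]
    simp_rw [gaussianDensity_mul_quadExp]
    refine (integrable_quadExp ?_ _).const_mul _
    have : 2 * b + 1 / (2 * s) = 2 * (b + 1 / (4 * s)) := by field_simp; ring
    rw [this]
    linarith
  refine h1.norm.congr (.of_forall fun q => ?_)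
  simp only [norm_quadExp, Complex.ofReal_re, ← Real.exp_nat_mul]
  congr 1
  simp only [mul_assoc, ← Finset.mul_sum]
  push_cast
  ring

/-- For this coefficient the slack in `memLp_quadExp` is `(2s - ħ)/(4sħ)`, so `s > ħ/2` is what puts
the kernel in `L²`. -/
lemma memLp_quadExp_kernel {n : ℕ} {s ħ : ℝ} (hħ : 0 < ħ) (hs : ħ / 2 < s) (c : Fin n → ℂ) :
    MemLp (quadExp (1 / (2 * ħ) - 1 / (2 * s)) c) 2 (gaussian n s) := by
  have hs0 : 0 < s := by linarith
  refine memLp_quadExp hs0 ?_ c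
  have : 1 / (2 * ħ) - 1 / (2 * s) + 1 / (4 * s) = (2 * s - ħ) / (4 * s * ħ) := by field_simp; ring
  rw [this]
  exact div_pos (by linarith) (by positivity)

lemma integral_quadExp {n : ℕ} {b : ℝ} (hb : 0 < b) (c : Fin n → ℂ) :
    ∫ q, quadExp b c q = (((Real.pi / b) ^ ((n : ℝ) / 2) : ℝ) : ℂ) *
      Complex.exp ((∑ k, c k ^ 2) / (4 * b)) := by
  have := GaussianFourier.integral_cexp_neg_mul_sum_add (b := (b : ℂ)) (by simpa using hb) c
  rw [Complex.ofReal_cpow (by positivity)]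
  simp only [quadExp]
  rw [this, Fintype.card_fin]
  push_cast
  rfl

/-- Domination for differentiating under the integral, uniform in `‖c‖ ≤ R`. The derivative factor
is at most `exp (∑ |q k|)`, and `(R + 1)|q| ≤ ε q² + (R + 1)²/(4ε)` pays for all linear terms with a
little quadratic decay. -/
lemma norm_quadExp_mul_sum_abs_le {n : ℕ} (b : ℝ) {c : Fin n → ℂ} {R ε : ℝ} (hR : ‖c‖ ≤ R)
    (hε : 0 < ε) (q : Fin n → ℝ) :
    ‖quadExp b c q‖ * ∑ k, |q k|
      ≤ Real.exp (n * ((R + 1) ^ 2 / (4 * ε))) * ‖quadExp (b - ε) (0 : Fin n → ℂ) q‖ := by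
  rw [norm_quadExp, norm_quadExp, ← Real.exp_add]
  have h1 : ∑ k, |q k| ≤ Real.exp (∑ k, |q k|) := by
    have := Real.add_one_le_exp (∑ k, |q k|)
    linarith
  refine (mul_le_mul_of_nonneg_left h1 (Real.exp_pos _).le).trans ?_
  rw [← Real.exp_add]
  refine Real.exp_le_exp.2 ?_
  have h2 : ∀ k, (c k).re * q k + |q k| ≤ ε * q k ^ 2 + (R + 1) ^ 2 / (4 * ε) := by
    intro k
    have h3 : |(c k).re| ≤ R := (Complex.abs_re_le_norm _).trans ((norm_le_pi_norm c k).trans hR)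
    have h4 : (c k).re * q k ≤ R * |q k| := by
      refine (le_abs_self _).trans ?_
      rw [abs_mul]
      exact mul_le_mul_of_nonneg_right h3 (abs_nonneg _)
    have h5 : (R + 1) * |q k| ≤ ε * |q k| ^ 2 + (R + 1) ^ 2 / (4 * ε) := by
      have h6 : ε * |q k| ^ 2 + (R + 1) ^ 2 / (4 * ε) - (R + 1) * |q k|
          = (2 * ε * |q k| - (R + 1)) ^ 2 / (4 * ε) := by field_simp; ring
      have h7 : 0 ≤ (2 * ε * |q k| - (R + 1)) ^ 2 / (4 * ε) := by positivity
      linarith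
    rw [sq_abs] at h5
    linarith
  have h3 := Finset.sum_le_sum fun k (_ : k ∈ Finset.univ) => h2 k
  simp only [Finset.sum_add_distrib, ← Finset.mul_sum, Finset.sum_const, Finset.card_univ,
    Fintype.card_fin, nsmul_eq_mul] at h3
  simp only [Pi.zero_apply, Complex.zero_re, zero_mul, Finset.sum_const_zero]
  linarith

lemma differentiable_integral_quadExp_mul {n : ℕ} {s : ℝ} (hs : 0 < s) {b : ℝ}
    (hb : 0 < b + 1 / (4 * s)) {φ : (Fin n → ℝ) → ℂ} (hφ : MemLp φ 2 (gaussian n s)) :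
    Differentiable ℂ fun c : Fin n → ℂ => ∫ q, quadExp b c q * φ q ∂gaussian n s := by
  intro c
  let l (q : Fin n → ℝ) : (Fin n → ℂ) →L[ℂ] ℂ :=
    ∑ k, (q k : ℂ) • ContinuousLinearMap.proj (R := ℂ) (φ := fun _ : Fin n => ℂ) k
  have hl : ∀ q, ‖l q‖ ≤ ∑ k, |q k| := fun q => by
    refine (norm_sum_le _ _).trans (Finset.sum_le_sum fun k _ => ?_)
    rw [norm_smul, Complex.norm_real, Real.norm_eq_abs]
    refine mul_le_of_le_one_right (abs_nonneg _) ?_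
    refine ContinuousLinearMap.opNorm_le_bound _ zero_le_one fun x => ?_
    rw [one_mul]
    exact norm_le_pi_norm x k
  have hlm : Continuous l := by fun_prop
  -- Giving up half of the available slack keeps the dominating Gaussian in `L²`.
  set ε := (b + 1 / (4 * s)) / 2 with hε
  have hεp : 0 < ε := by positivity
  have hbε : 0 < (b - ε) + 1 / (4 * s) := by rw [hε]; linarith
  refine (hasFDerivAt_integral_of_dominated_of_fderiv_le (s := Metric.ball c 1)
    (F' := fun c' q => (quadExp b c' q * φ q) • l q)
    (bound := fun q => Real.exp (n * ((‖c‖ + 1 + 1) ^ 2 / (4 * ε))) *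
      (‖quadExp (b - ε) (0 : Fin n → ℂ) q‖ * ‖φ q‖))
    (Metric.ball_mem_nhds c one_pos) (.of_forall fun c' => ?_) ?_ ?_ (.of_forall fun q c' hc' => ?_)
    ?_ (.of_forall fun q c' _ => ?_)).differentiableAt
  · exact (continuous_quadExp b c').aestronglyMeasurable.mul hφ.1
  · exact (memLp_quadExp hs hb c).integrable_mul hφ
  · exact ((continuous_quadExp b c).aestronglyMeasurable.mul hφ.1).smul hlm.aestronglyMeasurable
  · rw [norm_smul, norm_mul, mul_right_comm]
    have h1 : ‖c'‖ ≤ ‖c‖ + 1 := by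
      have h2 : ‖c' - c‖ < 1 := by simpa [dist_eq_norm] using hc'
      have h3 := norm_le_norm_add_norm_sub' c' c
      linarith
    rw [← mul_assoc]
    refine mul_le_mul_of_nonneg_right ?_ (norm_nonneg _)
    exact (mul_le_mul_of_nonneg_left (hl q) (norm_nonneg _)).trans
      (norm_quadExp_mul_sum_abs_le b h1 hεp q)
  · exact (((memLp_quadExp hs hbε 0).norm).integrable_mul hφ.norm).const_mul _
  · have h1 : HasFDerivAt (fun c : Fin n → ℂ => -(b : ℂ) * ∑ k, (q k : ℂ) ^ 2 + ∑ k, c k * q k)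
        (l q) c' := by
      refine HasFDerivAt.const_add _ ?_
      refine HasFDerivAt.congr_fderiv (HasFDerivAt.fun_sum fun k _ =>
        (((ContinuousLinearMap.proj (R := ℂ) (φ := fun _ : Fin n => ℂ) k).hasFDerivAt
          (x := c')).mul_const (q k : ℂ))) rfl
    have h2 := h1.cexp.mul_const (φ q)
    refine HasFDerivAt.congr_fderiv h2 ?_
    rw [quadExp, smul_smul, mul_comm]

end

/-! ### The holomorphic extension of the heat operator -/

section

/-- The analytic continuation of `heat ħ φ` to `ℂⁿ`, for `φ` in `L²` of the Gaussian measure of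
variance `s`. -/
def heatExt {n : ℕ} (s ħ : ℝ) (φ : (Fin n → ℝ) → ℂ) (z : Fin n → ℂ) : ℂ :=
  (((2 * Real.pi * ħ) ^ (-(n : ℝ) / 2) * √(2 * Real.pi * s) ^ n : ℝ) : ℂ) *
    Complex.exp (-(∑ k, z k ^ 2) / (2 * ħ)) *
    ∫ q, quadExp (1 / (2 * ħ) - 1 / (2 * s)) (fun k => z k / ħ) q * φ q ∂gaussian n s

/-- After division by the Gaussian density, `x` enters only through an entire prefactor and the
linear coefficient `x/ħ`, so `x` may be replaced by a complex vector. -/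
lemma heatKernel_eq {n : ℕ} {s ħ : ℝ} (hħ : 0 < ħ) (hs : 0 < s) (x q : Fin n → ℝ) :
    (heatKernel ħ x q : ℂ) = gaussianDensity s q *
      ((((2 * Real.pi * ħ) ^ (-(n : ℝ) / 2) * √(2 * Real.pi * s) ^ n : ℝ) : ℂ) *
        Complex.exp (-(∑ k, (x k : ℂ) ^ 2) / (2 * ħ)) *
        quadExp (1 / (2 * ħ) - 1 / (2 * s)) (fun k => (x k : ℂ) / ħ) q) := by
  have h1 : (gaussianDensity s q : ℂ) * quadExp (1 / (2 * ħ) - 1 / (2 * s))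
      (fun k => (x k : ℂ) / ħ) q = (((√(2 * Real.pi * s))⁻¹ ^ n : ℝ) : ℂ) *
      quadExp (1 / (2 * ħ)) (fun k => (x k : ℂ) / ħ) q := by
    rw [gaussianDensity_mul_quadExp, sub_add_cancel]
  have h2 : (((√(2 * Real.pi * s)) ^ n : ℝ) : ℂ) * (((√(2 * Real.pi * s))⁻¹ ^ n : ℝ) : ℂ) = 1 := by
    rw [← Complex.ofReal_mul, ← mul_pow, mul_inv_cancel₀, one_pow, Complex.ofReal_one]
    have := Real.pi_pos
    positivity
  have h3 : (Real.exp (-(∑ k, (x k - q k) ^ 2) / (2 * ħ)) : ℂ)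
      = Complex.exp (-(∑ k, (x k : ℂ) ^ 2) / (2 * ħ)) *
        quadExp (1 / (2 * ħ)) (fun k => (x k : ℂ) / ħ) q := by
    rw [quadExp, ← Complex.exp_add, Complex.ofReal_exp]
    congr 1
    have hħ' : (ħ : ℂ) ≠ 0 := by exact_mod_cast hħ.ne'
    have h4 : ∑ k, (x k : ℂ) / ħ * q k = (∑ k, (x k : ℂ) * q k) / ħ := by
      rw [Finset.sum_div]
      exact Finset.sum_congr rfl fun k _ => by ring
    have h5 : ∑ k, ((x k : ℂ) - q k) ^ 2
        = ∑ k, (x k : ℂ) ^ 2 - 2 * ∑ k, (x k : ℂ) * q k + ∑ k, (q k : ℂ) ^ 2 := by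
      rw [Finset.mul_sum, ← Finset.sum_sub_distrib, ← Finset.sum_add_distrib]
      exact Finset.sum_congr rfl fun k _ => by ring
    push_cast
    rw [h4, h5]
    field_simp
    ring
  rw [heatKernel, Complex.ofReal_mul, h3, Complex.ofReal_mul]
  calc _ = (((2 * Real.pi * ħ) ^ (-(n : ℝ) / 2) : ℝ) : ℂ) *
        (((√(2 * Real.pi * s)) ^ n : ℝ) * (((√(2 * Real.pi * s))⁻¹ ^ n : ℝ) : ℂ)) *
        (Complex.exp (-(∑ k, (x k : ℂ) ^ 2) / (2 * ħ)) *
          quadExp (1 / (2 * ħ)) (fun k => (x k : ℂ) / ħ) q) := by rw [h2, mul_one]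
    _ = _ := by
      rw [← mul_assoc (gaussianDensity s q : ℂ), mul_comm (gaussianDensity s q : ℂ),
        mul_assoc _ (gaussianDensity s q : ℂ), h1]
      ring

variable {n : ℕ} {s ħ : ℝ}

lemma integrable_quadExp_kernel_mul (hħ : 0 < ħ) (hs : ħ / 2 < s) {φ : (Fin n → ℝ) → ℂ}
    (hφ : MemLp φ 2 (gaussian n s)) (c : Fin n → ℂ) :
    Integrable (fun q => quadExp (1 / (2 * ħ) - 1 / (2 * s)) c q * φ q) (gaussian n s) :=
  (memLp_quadExp_kernel hħ hs c).integrable_mul hφ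

lemma integrable_heatKernel_mul (hħ : 0 < ħ) (hs : ħ / 2 < s) {φ : (Fin n → ℝ) → ℂ}
    (hφ : MemLp φ 2 (gaussian n s)) (x : Fin n → ℝ) :
    Integrable fun q => (heatKernel ħ x q : ℂ) * φ q := by
  have hs0 : 0 < s := by linarith
  have h1 := (integrable_gaussian_iff hs0).1 ((integrable_quadExp_kernel_mul hħ hs hφ
    fun k => (x k : ℂ) / ħ).const_mul ((((2 * Real.pi * ħ) ^ (-(n : ℝ) / 2) *
      √(2 * Real.pi * s) ^ n : ℝ) : ℂ) * Complex.exp (-(∑ k, (x k : ℂ) ^ 2) / (2 * ħ))))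
  refine h1.congr (.of_forall fun q => ?_)
  simp only
  rw [heatKernel_eq hħ hs0]
  ring

lemma heatExt_ofReal (hħ : 0 < ħ) (hs : ħ / 2 < s) (φ : (Fin n → ℝ) → ℂ) (x : Fin n → ℝ) :
    heatExt s ħ φ (fun k => (x k : ℂ)) = heat ħ φ x := by
  have hs0 : 0 < s := by linarith
  rw [heatExt, heat, integral_gaussian hs0, ← integral_const_mul]
  refine integral_congr_ae (.of_forall fun q => ?_)
  simp only
  rw [heatKernel_eq hħ hs0]
  ring

lemma differentiable_heatExt (hħ : 0 < ħ) (hs : ħ / 2 < s) {φ : (Fin n → ℝ) → ℂ}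
    (hφ : MemLp φ 2 (gaussian n s)) : Differentiable ℂ (heatExt s ħ φ) := by
  have hs0 : 0 < s := by linarith
  have hb : 0 < 1 / (2 * ħ) - 1 / (2 * s) + 1 / (4 * s) := by
    have : 1 / (2 * ħ) - 1 / (2 * s) + 1 / (4 * s) = (2 * s - ħ) / (4 * s * ħ) := by
      field_simp; ring
    rw [this]
    exact div_pos (by linarith) (by positivity)
  have h1 := (differentiable_integral_quadExp_mul hs0 hb hφ).comp
    (g := fun c : Fin n → ℂ => ∫ q, quadExp (1 / (2 * ħ) - 1 / (2 * s)) c q * φ q ∂gaussian n s)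
    (f := fun (z : Fin n → ℂ) k => z k / (ħ : ℂ)) (by fun_prop)
  have h2 : Differentiable ℂ fun z : Fin n → ℂ =>
      (((2 * Real.pi * ħ) ^ (-(n : ℝ) / 2) * √(2 * Real.pi * s) ^ n : ℝ) : ℂ) *
        Complex.exp (-(∑ k, z k ^ 2) / (2 * ħ)) := by fun_prop
  exact h2.mul h1

/-- The complex line `w ↦ Re z + w Im z` is real for real `w` and passes through `z` at `w = i`; the
identity theorem in one variable applies along it. -/
lemma eq_of_differentiable_of_eqOn_real {Φ Ψ : (Fin n → ℂ) → ℂ} (hΦ : Differentiable ℂ Φ)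
    (hΨ : Differentiable ℂ Ψ)
    (h : ∀ x : Fin n → ℝ, Φ (fun k => (x k : ℂ)) = Ψ fun k => (x k : ℂ)) : Φ = Ψ := by
  funext z
  let γ : ℂ → Fin n → ℂ := fun w k => ((z k).re : ℂ) + w * ((z k).im : ℂ)
  have hγ : Differentiable ℂ γ := by fun_prop
  have h1 : AnalyticOnNhd ℂ (Φ ∘ γ) Set.univ :=
    (hΦ.comp hγ).differentiableOn.analyticOnNhd isOpen_univ
  have h2 : AnalyticOnNhd ℂ (Ψ ∘ γ) Set.univ :=
    (hΨ.comp hγ).differentiableOn.analyticOnNhd isOpen_univ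
  have h3 : ∀ t : ℝ, (Φ ∘ γ) t = (Ψ ∘ γ) t := fun t => by
    have := h fun k => (z k).re + t * (z k).im
    simpa [γ] using this
  have h4 : ∃ᶠ w in nhdsWithin (0 : ℂ) {0}ᶜ, (Φ ∘ γ) w = (Ψ ∘ γ) w := by
    have h5 : Filter.Tendsto (fun t : ℝ => (t : ℂ)) (nhdsWithin (0 : ℝ) {0}ᶜ)
        (nhdsWithin (0 : ℂ) {0}ᶜ) := by
      refine tendsto_nhdsWithin_iff.2 ⟨?_, ?_⟩
      · exact (Complex.continuous_ofReal.tendsto' 0 0 (by simp)).mono_left nhdsWithin_le_nhds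
      · filter_upwards [self_mem_nhdsWithin] with t ht
        simpa using ht
    exact h5.frequently (Filter.Frequently.of_forall h3)
  have h6 := congrFun (h1.eq_of_frequently_eq h2 h4) Complex.I
  have h7 : γ Complex.I = z := by
    funext k
    simp only [γ]
    rw [mul_comm, Complex.re_add_im]
  simpa [h7] using h6

lemma isAnalyticContinuation_heatExt (hħ : 0 < ħ) (hs : ħ / 2 < s) {φ : (Fin n → ℝ) → ℂ}
    (hφ : MemLp φ 2 (gaussian n s)) : IsAnalyticContinuation (heat ħ φ) (heatExt s ħ φ) :=
  ⟨differentiable_heatExt hħ hs hφ, heatExt_ofReal hħ hs φ⟩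

lemma IsAnalyticContinuation.eq_heatExt (hħ : 0 < ħ) (hs : ħ / 2 < s) {φ : (Fin n → ℝ) → ℂ}
    (hφ : MemLp φ 2 (gaussian n s)) {Φ : (Fin n → ℂ) → ℂ}
    (hΦ : IsAnalyticContinuation (heat ħ φ) Φ) : Φ = heatExt s ħ φ :=
  eq_of_differentiable_of_eqOn_real hΦ.1 (differentiable_heatExt hħ hs hφ) fun x => by
    rw [hΦ.2, heatExt_ofReal hħ hs]

lemma heatExt_congr_ae {φ ψ : (Fin n → ℝ) → ℂ} (h : φ =ᵐ[gaussian n s] ψ) :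
    heatExt s ħ φ = heatExt s ħ ψ := by
  funext z
  rw [heatExt, heatExt]
  congr 1
  refine integral_congr_ae ?_
  filter_upwards [h] with q hq
  rw [hq]

lemma heatExt_add (hħ : 0 < ħ) (hs : ħ / 2 < s) {φ ψ : (Fin n → ℝ) → ℂ}
    (hφ : MemLp φ 2 (gaussian n s)) (hψ : MemLp ψ 2 (gaussian n s)) (z : Fin n → ℂ) :
    heatExt s ħ (φ + ψ) z = heatExt s ħ φ z + heatExt s ħ ψ z := by
  rw [heatExt, heatExt, heatExt, ← mul_add, ← integral_add (integrable_quadExp_kernel_mul hħ hs hφ _)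
    (integrable_quadExp_kernel_mul hħ hs hψ _)]
  simp only [Pi.add_apply, mul_add]

lemma heatExt_smul (a : ℂ) (φ : (Fin n → ℝ) → ℂ) (z : Fin n → ℂ) :
    heatExt s ħ (a • φ) z = a * heatExt s ħ φ z := by
  simp only [heatExt, Pi.smul_apply, smul_eq_mul, mul_left_comm _ a]
  rw [integral_const_mul, mul_left_comm]

/-- Up to a constant, evaluation at `z` is the inner product with a fixed `L²` function. Hence `L²`
limits pass to the continuation at every point. -/
lemma continuous_heatExt_apply (hħ : 0 < ħ) (hs : ħ / 2 < s) (z : Fin n → ℂ) :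
    Continuous fun φ : Lp ℂ 2 (gaussian n s) => heatExt s ħ φ z := by
  have hm := (memLp_quadExp_kernel hħ hs fun k => z k / (ħ : ℂ))
  have hc : MemLp (fun q => starRingEnd ℂ
      (quadExp (1 / (2 * ħ) - 1 / (2 * s)) (fun k => z k / (ħ : ℂ)) q)) 2 (gaussian n s) := hm.star
  have h1 : ∀ φ : Lp ℂ 2 (gaussian n s), ∫ q, quadExp (1 / (2 * ħ) - 1 / (2 * s))
      (fun k => z k / (ħ : ℂ)) q * φ q ∂gaussian n s = inner ℂ hc.toLp φ := by
    intro φ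
    rw [L2.inner_def]
    refine integral_congr_ae ?_
    filter_upwards [hc.coeFn_toLp] with q hq
    rw [hq, RCLike.inner_apply, RCLike.conj_conj, mul_comm]
  simp only [heatExt, h1]
  fun_prop

/-- One Gaussian integral covers both the characters (`b = 0`, imaginary `c`) and the preimages of
the coherent states. -/
lemma heatExt_quadExp (hs : 0 < s) {b : ℝ} (hb : 0 < b + 1 / (2 * ħ)) (c z : Fin n → ℂ) :
    heatExt s ħ (quadExp b c) z = (((2 * Real.pi * ħ) ^ (-(n : ℝ) / 2) *
      (Real.pi / (b + 1 / (2 * ħ))) ^ ((n : ℝ) / 2) : ℝ) : ℂ) *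
      Complex.exp (-(∑ k, z k ^ 2) / (2 * ħ) +
        (∑ k, (z k / ħ + c k) ^ 2) / (4 * ((b + 1 / (2 * ħ) : ℝ) : ℂ))) := by
  have h2 : (((√(2 * Real.pi * s)) ^ n : ℝ) : ℂ) * (((√(2 * Real.pi * s))⁻¹ ^ n : ℝ) : ℂ) = 1 := by
    rw [← Complex.ofReal_mul, ← mul_pow, mul_inv_cancel₀, one_pow, Complex.ofReal_one]
    have := Real.pi_pos
    positivity
  have h3 : 1 / (2 * ħ) - 1 / (2 * s) + b + 1 / (2 * s) = b + 1 / (2 * ħ) := by ring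
  rw [heatExt, integral_gaussian hs]
  simp_rw [quadExp_mul_quadExp, gaussianDensity_mul_quadExp]
  rw [integral_const_mul, h3, integral_quadExp hb, Complex.ofReal_mul, Complex.ofReal_mul,
    Complex.exp_add]
  simp only [Pi.add_apply]
  generalize Complex.exp (-(∑ k, z k ^ 2) / (2 * ħ)) = x
  generalize (((2 * Real.pi * ħ) ^ (-(n : ℝ) / 2) : ℝ) : ℂ) = y
  linear_combination (x * y * (((Real.pi / (b + 1 / (2 * ħ))) ^ ((n : ℝ) / 2) : ℝ) : ℂ) *
    Complex.exp ((∑ k, (z k / ħ + c k) ^ 2) / (4 * ((b + 1 / (2 * ħ) : ℝ) : ℂ)))) * h2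

lemma heatExt_character (hħ : 0 < ħ) (hs : 0 < s) (t : Fin n → ℝ) (z : Fin n → ℂ) :
    heatExt s ħ (quadExp 0 fun k => Complex.I * t k) z
      = Complex.exp (-(ħ / 2 * ∑ k, t k ^ 2 : ℝ)) * Complex.exp (Complex.I * ∑ k, t k * z k) := by
  have hħ' : (ħ : ℂ) ≠ 0 := by exact_mod_cast hħ.ne'
  rw [heatExt_quadExp hs (by positivity), zero_add]
  have h1 : Real.pi / (1 / (2 * ħ)) = 2 * Real.pi * ħ := by field_simp
  have h2 : 0 < 2 * Real.pi * ħ := by have := Real.pi_pos; positivity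
  rw [h1, ← Real.rpow_add h2, neg_div, neg_add_cancel, Real.rpow_zero, Complex.ofReal_one, one_mul,
    ← Complex.exp_add]
  congr 1
  have h3 : ∑ k, (z k / ħ + Complex.I * t k) ^ 2 = (∑ k, z k ^ 2) / ħ ^ 2
      + 2 * Complex.I / ħ * ∑ k, t k * z k - ∑ k, (t k : ℂ) ^ 2 := by
    rw [Finset.sum_div, Finset.mul_sum, ← Finset.sum_add_distrib, ← Finset.sum_sub_distrib]
    refine Finset.sum_congr rfl fun k _ => ?_
    linear_combination ((t k : ℂ) ^ 2) * Complex.I_sq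
  rw [h3]
  push_cast
  field_simp
  ring

end

/-! ### The reproducing property in the holomorphic Gaussian space -/

section

/-- The function `z ↦ e^{-a |z|²}` on `ℂⁿ`. -/
def fockWeight {n : ℕ} (a : ℝ) (z : Fin n → ℂ) : ℂ :=
  Complex.exp (∑ k, -(a : ℂ) * (z k * starRingEnd ℂ (z k)))

lemma integral_fockWeight_ne_zero {n : ℕ} {a : ℝ} (ha : 0 < a) :
    ∫ z : Fin n → ℂ, fockWeight a z ≠ 0 := by
  have h1 : ∀ z : Fin n → ℂ, fockWeight a z = ∏ k, Complex.exp (-(a : ℂ) * (‖z k‖ : ℂ) ^ 2) := by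
    intro z
    rw [fockWeight, Complex.exp_sum]
    refine Finset.prod_congr rfl fun k _ => ?_
    rw [Complex.mul_conj, Complex.normSq_eq_norm_sq]
    push_cast
    rfl
  simp_rw [h1]
  rw [integral_fintype_prod_volume_eq_prod fun (_ : Fin n) (x : ℂ) =>
    Complex.exp (-(a : ℂ) * (‖x‖ : ℂ) ^ 2)]
  refine Finset.prod_ne_zero_iff.2 fun k _ => ?_
  rw [GaussianFourier.integral_cexp_neg_mul_sq_norm (V := ℂ) (by simpa using ha),
    Complex.cpow_ne_zero_iff]
  left
  have h2 : (a : ℂ) ≠ 0 := by exact_mod_cast ha.ne'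
  have h3 : (Real.pi : ℂ) ≠ 0 := by exact_mod_cast Real.pi_ne_zero
  exact div_ne_zero h3 h2

lemma measurePreserving_rotation {n : ℕ} (u : Circle) :
    MeasurePreserving (fun (z : Fin n → ℂ) k => (u : ℂ) * z k) :=
  volume_preserving_pi fun _ => (rotation u).measurePreserving

lemma fockWeight_rotation {n : ℕ} (a : ℝ) (u : Circle) (z : Fin n → ℂ) :
    fockWeight a (fun k => (u : ℂ) * z k) = fockWeight a z := by
  rw [fockWeight, fockWeight]
  congr 1
  refine Finset.sum_congr rfl fun k _ => ?_
  have : (u : ℂ) * starRingEnd ℂ (u : ℂ) = 1 := by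
    rw [Complex.mul_conj, Circle.normSq_coe, Complex.ofReal_one]
  rw [map_mul]
  linear_combination (-(a : ℂ) * (z k * starRingEnd ℂ (z k))) * this

lemma continuous_fockWeight {n : ℕ} (a : ℝ) : Continuous (fockWeight a : (Fin n → ℂ) → ℂ) := by
  unfold fockWeight
  exact Complex.continuous_exp.comp (continuous_finsetSum _ fun k _ => continuous_const.mul
    ((continuous_apply k).mul (Complex.continuous_conj.comp (continuous_apply k))))

/-- Lebesgue measure and the weight are invariant under `z ↦ e^{it} z`. Averaging over `t` and
exchanging integrals replaces `θ z` by the circle mean of `w ↦ θ (w z)`, which is `θ 0`. -/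
lemma integral_mul_fockWeight {n : ℕ} {a : ℝ} {θ : (Fin n → ℂ) → ℂ} (hθ : Differentiable ℂ θ)
    (hi : Integrable fun z => θ z * fockWeight a z) :
    ∫ z, θ z * fockWeight a z = θ 0 * ∫ z : Fin n → ℂ, fockWeight a z := by
  let F : ℝ → (Fin n → ℂ) → ℂ := fun t z => θ (fun k => (Circle.exp t : ℂ) * z k) * fockWeight a z
  have hF : ∀ t z, F t z = (fun z => θ z * fockWeight a z) fun k => (Circle.exp t : ℂ) * z k :=
    fun t z => by simp only [F]; rw [fockWeight_rotation]
  have hme : ∀ t, MeasurableEmbedding fun (z : Fin n → ℂ) k => (Circle.exp t : ℂ) * z k := by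
    intro t
    have : Continuous fun (z : Fin n → ℂ) k => (Circle.exp t : ℂ) * z k := by fun_prop
    refine this.measurableEmbedding fun z w hzw => funext fun k => ?_
    exact mul_left_cancel₀ (Circle.coe_ne_zero _) (congrFun hzw k)
  have hFi : ∀ t, Integrable (F t) := fun t => by
    have := ((measurePreserving_rotation (Circle.exp t)).integrable_comp_emb (hme t)).2 hi
    exact this.congr (.of_forall fun z => (hF t z).symm)
  have hFint : ∀ t, ∫ z, F t z = ∫ z, θ z * fockWeight a z := fun t => by
    refine (integral_congr_ae (.of_forall fun z => hF t z)).trans ?_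
    exact (measurePreserving_rotation (Circle.exp t)).integral_comp (hme t)
      fun z => θ z * fockWeight a z
  have hFnorm : ∀ t, ∫ z, ‖F t z‖ = ∫ z, ‖θ z * fockWeight a z‖ := fun t => by
    refine (integral_congr_ae (.of_forall fun z => congrArg norm (hF t z))).trans ?_
    exact (measurePreserving_rotation (Circle.exp t)).integral_comp (hme t)
      fun z => ‖θ z * fockWeight a z‖
  have hFc : Continuous (Function.uncurry F) := by
    have h1 : Continuous fun p : ℝ × (Fin n → ℂ) => θ (fun k => (Circle.exp p.1 : ℂ) * p.2 k) := by
      refine hθ.continuous.comp ?_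
      fun_prop
    exact h1.mul ((continuous_fockWeight a).comp continuous_snd)
  set I := Set.Ioc (0 : ℝ) (2 * Real.pi)
  -- By rotation invariance the norm integrals over `z` do not depend on `t`, so integrability over
  -- the finite interval is immediate.
  have hint : Integrable (Function.uncurry F) ((volume.restrict I).prod volume) := by
    refine (integrable_prod_iff hFc.aestronglyMeasurable).2 ⟨.of_forall hFi, ?_⟩
    simp only [Function.uncurry_apply_pair, hFnorm]
    exact integrable_const _
  have hmean : ∀ z, ∫ t in I, F t z = (2 * Real.pi : ℝ) * (θ 0 * fockWeight a z) := by
    intro z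
    have h1 : Differentiable ℂ fun w : ℂ => θ (fun k => w * z k) := hθ.comp (by fun_prop)
    have h2 : Real.circleAverage (fun w : ℂ => θ (fun k => w * z k)) 0 1 = θ (fun k => 0 * z k) :=
      h1.diffContOnCl.circleAverage
    have h3 : (fun k => 0 * z k) = (0 : Fin n → ℂ) := funext fun k => zero_mul _
    rw [h3, Real.circleAverage, intervalIntegral.integral_of_le Real.two_pi_pos.le] at h2
    simp only [F]
    rw [integral_mul_const, ← h2]
    simp only [circleMap, zero_add, Complex.ofReal_one, one_mul, Circle.coe_exp, Complex.real_smul]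
    have h4 : (((2 * Real.pi : ℝ)) : ℂ) ≠ 0 := by exact_mod_cast Real.two_pi_pos.ne'
    generalize (∫ t in I, θ fun k => Complex.exp (t * Complex.I) * z k) = J
    rw [Complex.ofReal_inv]
    field_simp
  have hswap := integral_integral_swap hint
  simp only [hFint, hmean] at hswap
  rw [integral_const, integral_const_mul, integral_const_mul, Complex.real_smul] at hswap
  have h5 : (volume.restrict I).real Set.univ = 2 * Real.pi := by
    simp [I, Measure.real, Real.pi_pos.le]
  rw [h5] at hswap
  exact mul_left_cancel₀ (by exact_mod_cast Real.two_pi_pos.ne') hswap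

/-- The shift `z ↦ z + w` turns the exponent `a w·z̄ - a|z|²` into `-a w̄·z - a|z|²`. What
multiplies the weight is then entire, with value `Ψ w` at the origin, and the mean value property
applies. -/
theorem eq_zero_of_integral_reproducing_eq_zero {n : ℕ} {a : ℝ} (ha : 0 < a)
    {Ψ : (Fin n → ℂ) → ℂ} (hΨ : Differentiable ℂ Ψ) (w : Fin n → ℂ)
    (hi : Integrable fun z => Ψ z *
      (Complex.exp (∑ k, (a : ℂ) * w k * starRingEnd ℂ (z k)) * fockWeight a z))
    (h : ∫ z, Ψ z * (Complex.exp (∑ k, (a : ℂ) * w k * starRingEnd ℂ (z k)) * fockWeight a z) = 0) :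
    Ψ w = 0 := by
  let θ : (Fin n → ℂ) → ℂ := fun z =>
    Ψ (z + w) * Complex.exp (∑ k, -(a : ℂ) * (starRingEnd ℂ (w k)) * z k)
  have hθ : Differentiable ℂ θ := by
    have h1 : Differentiable ℂ fun z => Ψ (z + w) := hΨ.comp (by fun_prop)
    exact h1.mul (by fun_prop)
  have heq : ∀ z, Ψ (z + w) * (Complex.exp (∑ k, (a : ℂ) * w k * starRingEnd ℂ ((z + w) k)) *
      fockWeight a (z + w)) = θ z * fockWeight a z := by
    intro z
    simp only [θ, fockWeight]
    rw [mul_assoc, ← Complex.exp_add, ← Complex.exp_add, ← Finset.sum_add_distrib,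
      ← Finset.sum_add_distrib]
    congr 2
    refine Finset.sum_congr rfl fun k _ => ?_
    simp only [Pi.add_apply, map_add]
    ring
  have hi' := hi.comp_add_right w
  have h' := h
  rw [← integral_add_right_eq_self _ w] at h'
  simp only [heq] at hi' h'
  rw [integral_mul_fockWeight hθ hi'] at h'
  have h2 := (mul_eq_zero.1 h').resolve_right (integral_fockWeight_ne_zero ha)
  simpa [θ, Complex.exp_ne_zero] using h2

end

/-! ### Coherent states -/

section

/-- The density of `complexGaussian s ħ`. -/
def complexDensity (s ħ : ℝ) (z : ℂ) : ℝ :=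
  gaussianPDFReal 0 ((2 * s - ħ) / 2).toNNReal z.re * gaussianPDFReal 0 (ħ / 2).toNNReal z.im

lemma measurable_complexDensity (s ħ : ℝ) : Measurable (complexDensity s ħ) :=
  ((measurable_gaussianPDFReal _ _).comp Complex.measurable_re).mul
    ((measurable_gaussianPDFReal _ _).comp Complex.measurable_im)

lemma complexDensity_nonneg (s ħ : ℝ) (z : ℂ) : 0 ≤ complexDensity s ħ z :=
  mul_nonneg (gaussianPDFReal_nonneg _ _ _) (gaussianPDFReal_nonneg _ _ _)

lemma integrable_complexDensity (s ħ : ℝ) : Integrable (complexDensity s ħ) := by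
  have h1 : Integrable fun x : ℝ × ℝ => gaussianPDFReal 0 ((2 * s - ħ) / 2).toNNReal x.1 *
      gaussianPDFReal 0 (ħ / 2).toNNReal x.2 :=
    (integrable_gaussianPDFReal _ _).mul_prod (integrable_gaussianPDFReal _ _)
  exact (Complex.volume_preserving_equiv_real_prod.integrable_comp_emb
    Complex.measurableEquivRealProd.measurableEmbedding).2 h1

lemma complexGaussian_eq_withDensity {s ħ : ℝ} (hħ : 0 < ħ) (hs : ħ / 2 < s) :
    complexGaussian s ħ = volume.withDensity fun z => ENNReal.ofReal (complexDensity s ħ z) := by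
  have h1 : ((2 * s - ħ) / 2).toNNReal ≠ 0 := by simpa using by linarith
  have h2 : (ħ / 2).toNNReal ≠ 0 := by simpa using hħ
  rw [complexGaussian, gaussianReal_of_var_ne_zero _ h1, gaussianReal_of_var_ne_zero _ h2,
    prod_withDensity (measurable_gaussianPDF _ _) (measurable_gaussianPDF _ _)]
  have h3 : (fun x : ℝ × ℝ => (x.1 : ℂ) + Complex.I * (x.2 : ℂ))
      = Complex.measurableEquivRealProd.symm := by
    funext x
    apply Complex.ext <;> simp [Complex.measurableEquivRealProd_symm_apply]
  rw [h3]
  have h4 := Complex.volume_preserving_equiv_real_prod.symm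
  refine Measure.ext fun S hS => ?_
  rw [Measure.map_apply (MeasurableEquiv.measurable _) hS, withDensity_apply _ hS,
    withDensity_apply _ (hS.preimage (MeasurableEquiv.measurable _)),
    ← h4.setLIntegral_comp_preimage hS (measurable_complexDensity s ħ).ennreal_ofReal]
  refine lintegral_congr fun x => ?_
  rw [complexDensity, ENNReal.ofReal_mul (gaussianPDFReal_nonneg _ _ _)]
  simp [gaussianPDF, Complex.measurableEquivRealProd_symm_apply]

variable {n : ℕ} {s ħ : ℝ}

lemma pi_complexGaussian_eq_withDensity (hħ : 0 < ħ) (hs : ħ / 2 < s) :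
    (Measure.pi fun _ : Fin n => complexGaussian s ħ)
      = volume.withDensity fun z => ENNReal.ofReal (∏ k, complexDensity s ħ (z k)) := by
  rw [complexGaussian_eq_withDensity hħ hs, volume_pi]
  exact pi_withDensity_ofReal (complexDensity_nonneg s ħ) (integrable_complexDensity s ħ)

lemma measurable_prod_complexDensity :
    Measurable fun z : Fin n → ℂ => ∏ k, complexDensity s ħ (z k) :=
  Finset.measurable_prod _ fun k _ => (measurable_complexDensity s ħ).comp (measurable_pi_apply k)

lemma integral_pi_complexGaussian (hħ : 0 < ħ) (hs : ħ / 2 < s) (f : (Fin n → ℂ) → ℂ) :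
    ∫ z, f z ∂(Measure.pi fun _ => complexGaussian s ħ)
      = ∫ z, ((∏ k, complexDensity s ħ (z k) : ℝ) : ℂ) * f z := by
  rw [pi_complexGaussian_eq_withDensity hħ hs, integral_withDensity_eq_integral_toReal_smul
    measurable_prod_complexDensity.ennreal_ofReal (by simp)]
  refine integral_congr_ae (.of_forall fun z => ?_)
  simp only
  rw [ENNReal.toReal_ofReal (Finset.prod_nonneg fun k _ => complexDensity_nonneg s ħ _),
    Complex.real_smul]

lemma integrable_pi_complexGaussian_iff (hħ : 0 < ħ) (hs : ħ / 2 < s) {f : (Fin n → ℂ) → ℂ} :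
    Integrable f (Measure.pi fun _ => complexGaussian s ħ)
      ↔ Integrable fun z => ((∏ k, complexDensity s ħ (z k) : ℝ) : ℂ) * f z := by
  rw [pi_complexGaussian_eq_withDensity hħ hs, integrable_withDensity_iff_integrable_smul'
    measurable_prod_complexDensity.ennreal_ofReal (by simp)]
  refine integrable_congr (.of_forall fun z => ?_)
  simp only
  rw [ENNReal.toReal_ofReal (Finset.prod_nonneg fun k _ => complexDensity_nonneg s ħ _),
    Complex.real_smul]

/-- The coherent state `z ↦ e^{β z² / 2 + a w̄·z}` with `a = s / (rħ)`, `β = (1 / r - 1 / ħ) / 2` and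
`r = 2s - ħ`. -/
def coherentState (s ħ : ℝ) (w z : Fin n → ℂ) : ℂ :=
  Complex.exp (∑ k, ((((1 / (2 * s - ħ) - 1 / ħ) / 4 : ℝ) : ℂ) * z k ^ 2 +
    ((s / ((2 * s - ħ) * ħ) : ℝ) : ℂ) * starRingEnd ℂ (w k) * z k))

/-- Writing `q` and `p` through `z` and `z̄` splits the density into a holomorphic factor, its
conjugate and `e^{-a|z|²}`, where `a = (1/r + 1/ħ)/2 = s/(rħ)`. -/
lemma prod_complexDensity_eq (hħ : 0 < ħ) (hs : ħ / 2 < s) :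
    ∃ C : ℂ, C ≠ 0 ∧ ∀ z : Fin n → ℂ, ((∏ k, complexDensity s ħ (z k) : ℝ) : ℂ)
      = C * (Complex.exp (∑ k, -(((1 / (2 * s - ħ) - 1 / ħ) / 4 : ℝ) : ℂ) *
        (z k ^ 2 + starRingEnd ℂ (z k) ^ 2)) * fockWeight (s / ((2 * s - ħ) * ħ)) z) := by
  have hr : 0 < 2 * s - ħ := by linarith
  have h1 : (((2 * s - ħ) / 2).toNNReal : ℝ) = (2 * s - ħ) / 2 :=
    Real.coe_toNNReal _ (by linarith)
  have h2 : ((ħ / 2).toNNReal : ℝ) = ħ / 2 := Real.coe_toNNReal _ (by linarith)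
  let c : ℝ := (√(2 * Real.pi * ((2 * s - ħ) / 2)))⁻¹ * (√(2 * Real.pi * (ħ / 2)))⁻¹
  have hc : c ≠ 0 := by
    have := Real.pi_pos
    have h3 : 0 < √(2 * Real.pi * ((2 * s - ħ) / 2)) := Real.sqrt_pos.2 (by positivity)
    have h4 : 0 < √(2 * Real.pi * (ħ / 2)) := Real.sqrt_pos.2 (by positivity)
    positivity
  refine ⟨(c : ℂ) ^ n, pow_ne_zero _ (by exact_mod_cast hc), fun z => ?_⟩
  have hz : ∀ z : ℂ, (complexDensity s ħ z : ℂ) = c * Complex.exp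
      (-(((1 / (2 * s - ħ) - 1 / ħ) / 4 : ℝ) : ℂ) * (z ^ 2 + starRingEnd ℂ z ^ 2) +
        -((s / ((2 * s - ħ) * ħ) : ℝ) : ℂ) * (z * starRingEnd ℂ z)) := by
    intro z
    have h5 : complexDensity s ħ z
        = c * Real.exp (-(z.re ^ 2 / (2 * s - ħ)) - z.im ^ 2 / ħ) := by
      rw [complexDensity, gaussianPDFReal, gaussianPDFReal, h1, h2, sub_zero, sub_zero,
        mul_mul_mul_comm, ← Real.exp_add]
      congr 2
      field_simp
      ring
    rw [h5, Complex.ofReal_mul, Complex.ofReal_exp]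
    congr 2
    have h6 : z ^ 2 + starRingEnd ℂ z ^ 2 = ((2 * (z.re ^ 2 - z.im ^ 2) : ℝ) : ℂ) := by
      apply Complex.ext <;> simp [sq] <;> ring
    have h7 : z * starRingEnd ℂ z = ((z.re ^ 2 + z.im ^ 2 : ℝ) : ℂ) := by
      rw [Complex.mul_conj, Complex.normSq_apply]
      congr 1
      ring
    rw [h6, h7]
    norm_cast
    field_simp
    ring
  rw [Complex.ofReal_prod]
  simp_rw [hz]
  rw [Finset.prod_mul_distrib, Finset.prod_const, Finset.card_univ, Fintype.card_fin,
    ← Complex.exp_sum, Finset.sum_add_distrib, Complex.exp_add, fockWeight]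

/-- The quadratic part of the conjugated coherent state cancels the antiholomorphic factor of the
density. The holomorphic factor is absorbed into `Ψ`, and the reproducing property shows `Ψ w = 0`.
-/
theorem eq_zero_of_orthogonal_coherentState (hħ : 0 < ħ) (hs : ħ / 2 < s) {Φ : (Fin n → ℂ) → ℂ}
    (hΦ : Differentiable ℂ Φ)
    (hi : ∀ w, Integrable (fun z => starRingEnd ℂ (coherentState s ħ w z) * Φ z)
      (Measure.pi fun _ => complexGaussian s ħ))
    (h : ∀ w, ∫ z, starRingEnd ℂ (coherentState s ħ w z) * Φ z
      ∂(Measure.pi fun _ => complexGaussian s ħ) = 0) : Φ = 0 := by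
  obtain ⟨C, hC, hD⟩ := prod_complexDensity_eq (n := n) hħ hs
  have hr : 0 < 2 * s - ħ := by linarith
  have ha : 0 < s / ((2 * s - ħ) * ħ) := div_pos (by linarith) (mul_pos hr hħ)
  let Ψ : (Fin n → ℂ) → ℂ := fun z => Φ z *
    Complex.exp (∑ k, -(((1 / (2 * s - ħ) - 1 / ħ) / 4 : ℝ) : ℂ) * z k ^ 2)
  have hΨ : Differentiable ℂ Ψ := hΦ.mul (by fun_prop)
  have hpt : ∀ w z, ((∏ k, complexDensity s ħ (z k) : ℝ) : ℂ) *
      (starRingEnd ℂ (coherentState s ħ w z) * Φ z) = C * (Ψ z *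
        (Complex.exp (∑ k, ((s / ((2 * s - ħ) * ħ) : ℝ) : ℂ) * w k * starRingEnd ℂ (z k)) *
          fockWeight (s / ((2 * s - ħ) * ħ)) z)) := by
    intro w z
    have h1 : Complex.exp (∑ k, -(((1 / (2 * s - ħ) - 1 / ħ) / 4 : ℝ) : ℂ) *
        (z k ^ 2 + starRingEnd ℂ (z k) ^ 2)) * starRingEnd ℂ (coherentState s ħ w z)
        = Complex.exp (∑ k, -(((1 / (2 * s - ħ) - 1 / ħ) / 4 : ℝ) : ℂ) * z k ^ 2) *
          Complex.exp (∑ k, ((s / ((2 * s - ħ) * ħ) : ℝ) : ℂ) * w k * starRingEnd ℂ (z k)) := by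
      rw [coherentState, ← Complex.exp_conj, ← Complex.exp_add, ← Complex.exp_add, map_sum,
        ← Finset.sum_add_distrib, ← Finset.sum_add_distrib]
      congr 1
      refine Finset.sum_congr rfl fun k _ => ?_
      simp only [map_add, map_mul, map_pow, Complex.conj_ofReal, Complex.conj_conj]
      ring
    rw [hD]
    simp only [Ψ]
    linear_combination (C * Φ z * fockWeight (s / ((2 * s - ħ) * ħ)) z) * h1
  funext w
  have hi' := (integrable_pi_complexGaussian_iff hħ hs).1 (hi w)
  have h' := h w
  rw [integral_pi_complexGaussian hħ hs] at h'
  simp only [hpt] at hi' h'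
  rw [integral_const_mul] at h'
  have h2 := eq_zero_of_integral_reproducing_eq_zero ha hΨ w
    ((integrable_const_mul_iff (IsUnit.mk0 C hC) _).1 hi') ((mul_eq_zero.1 h').resolve_left hC)
  simpa [Ψ, Complex.exp_ne_zero] using h2

lemma exists_heatExt_eq_coherentState (hħ : 0 < ħ) (hs : ħ / 2 < s) (w : Fin n → ℂ) :
    ∃ (b : ℝ) (c : Fin n → ℂ) (K : ℂ), K ≠ 0 ∧ MemLp (quadExp b c) 2 (gaussian n s) ∧
      ∀ z, heatExt s ħ (quadExp b c) z = K * coherentState s ħ w z := by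
  have hs0 : 0 < s := by linarith
  have hr : 0 < 2 * s - ħ := by linarith
  have hB : (s - ħ) / (2 * s * ħ) + 1 / (2 * ħ) = (2 * s - ħ) / (2 * s * ħ) := by field_simp; ring
  have hB0 : 0 < (2 * s - ħ) / (2 * s * ħ) := by positivity
  -- Put `B = b + 1/(2ħ)`. Matching the coefficients of `z²`, `1/(4ħ²B) - 1/(2ħ) = (1/r - 1/ħ)/4`,
  -- gives `B = r/(2sħ)`; matching those of `z`, `c/(2ħB) = s w̄/(rħ)`, gives `c = w̄/ħ`. The term
  -- `c²/(4B)` goes into `K`.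
  refine ⟨(s - ħ) / (2 * s * ħ), fun k => starRingEnd ℂ (w k) / ħ,
    (((2 * Real.pi * ħ) ^ (-(n : ℝ) / 2) *
      (Real.pi / ((2 * s - ħ) / (2 * s * ħ))) ^ ((n : ℝ) / 2) : ℝ) : ℂ) *
      Complex.exp (∑ k, ((s / (2 * (2 * s - ħ) * ħ) : ℝ) : ℂ) * starRingEnd ℂ (w k) ^ 2),
    ?_, ?_, fun z => ?_⟩
  · refine mul_ne_zero ?_ (Complex.exp_ne_zero _)
    have := Real.pi_pos
    have h1 : 0 < (2 * Real.pi * ħ) ^ (-(n : ℝ) / 2) *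
      (Real.pi / ((2 * s - ħ) / (2 * s * ħ))) ^ ((n : ℝ) / 2) := by positivity
    exact_mod_cast h1.ne'
  · refine memLp_quadExp hs0 ?_ _
    have : (s - ħ) / (2 * s * ħ) + 1 / (4 * s) = (2 * s - ħ) / (4 * s * ħ) := by field_simp; ring
    rw [this]
    positivity
  · rw [heatExt_quadExp hs0 (by rw [hB]; exact hB0), hB, coherentState, mul_assoc (Complex.ofReal _),
      ← Complex.exp_add, ← Finset.sum_add_distrib, ← Finset.sum_neg_distrib, Finset.sum_div,
      Finset.sum_div, ← Finset.sum_add_distrib]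
    congr 2
    refine Finset.sum_congr rfl fun k _ => ?_
    have h1 : (ħ : ℂ) ≠ 0 := by exact_mod_cast hħ.ne'
    have h2 : (s : ℂ) ≠ 0 := by exact_mod_cast hs0.ne'
    have h3 : (2 * s - ħ : ℂ) ≠ 0 := by exact_mod_cast hr.ne'
    push_cast
    field_simp
    ring

end

/-! ### The transform as a linear isometry -/

section

/-- Equal Gram matrices give corresponding finite combinations equal norms. The map is therefore
well defined without linear independence, and it extends by density and completeness. -/
theorem exists_linearIsometry_of_inner_eq {X H K : Type*} [NormedAddCommGroup H]
    [InnerProductSpace ℂ H] [NormedAddCommGroup K] [InnerProductSpace ℂ K] [CompleteSpace K]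
    {E : X → H} {G : X → K} (hE : (Submodule.span ℂ (Set.range E)).topologicalClosure = ⊤)
    (h : ∀ x y, inner ℂ (E x) (E y) = inner ℂ (G x) (G y)) :
    ∃ U : H →ₗᵢ[ℂ] K, ∀ x, U (E x) = G x := by
  let e := Finsupp.linearCombination ℂ E
  let f := Finsupp.linearCombination ℂ G
  have hd : DenseRange e := by
    have : Set.range e = (Submodule.span ℂ (Set.range E) : Set H) := by
      rw [← Finsupp.range_linearCombination]
      rfl
    rw [DenseRange, this]
    exact (Submodule.dense_iff_topologicalClosure_eq_top).2 hE
  have hn : ∀ v, ‖f v‖ = ‖e v‖ := by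
    intro v
    have h1 : inner ℂ (f v) (f v) = inner ℂ (e v) (e v) := by
      simp only [e, f, Finsupp.linearCombination_apply, Finsupp.sum_inner, Finsupp.inner_sum,
        inner_smul_left, inner_smul_right, h]
    rw [norm_eq_sqrt_re_inner (𝕜 := ℂ), h1, ← norm_eq_sqrt_re_inner (𝕜 := ℂ)]
  have hle : ∀ v, ‖f v‖ ≤ 1 * ‖e v‖ := fun v => by rw [hn, one_mul]
  have heq : ∀ v, f.extendOfNorm e (e v) = f v := fun v =>
    LinearMap.extendOfNorm_eq hd ⟨1, hle⟩ v
  refine ⟨⟨(f.extendOfNorm e).toLinearMap, fun x => ?_⟩, fun x => ?_⟩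
  · refine hd.induction_on (p := fun x => ‖f.extendOfNorm e x‖ = ‖x‖) x
      (isClosed_eq (by fun_prop) (by fun_prop)) fun v => ?_
    rw [heq, hn]
  · have := heq (Finsupp.single x 1)
    simpa [e, f] using this

/-- For `z = q + ip` the product is `e^{i(u-t)q} e^{-(u+t)p}`: a characteristic function in `q`
times a moment generating function in `p`. -/
lemma integrable_character_mul_conj_complexGaussian (s ħ : ℝ) (t u : ℝ) :
    Integrable (fun z : ℂ => Complex.exp (Complex.I * (u * z)) *
      starRingEnd ℂ (Complex.exp (Complex.I * (t * z)))) (complexGaussian s ħ) ∧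
    ∫ z, Complex.exp (Complex.I * (u * z)) * starRingEnd ℂ (Complex.exp (Complex.I * (t * z)))
      ∂complexGaussian s ħ = Complex.exp ((-(((2 * s - ħ) / 2).toNNReal * (u - t) ^ 2 / 2) +
        (ħ / 2).toNNReal * (u + t) ^ 2 / 2 : ℝ)) := by
  have hm : AEMeasurable (fun x : ℝ × ℝ => (x.1 : ℂ) + Complex.I * (x.2 : ℂ))
      ((gaussianReal 0 ((2 * s - ħ) / 2).toNNReal).prod (gaussianReal 0 (ħ / 2).toNNReal)) := by
    fun_prop
  have hf : ∀ μ : Measure ℂ, AEStronglyMeasurable (fun z : ℂ => Complex.exp (Complex.I * (u * z)) *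
      starRingEnd ℂ (Complex.exp (Complex.I * (t * z)))) μ := fun μ => by
    refine Continuous.aestronglyMeasurable ?_
    have h1 : Continuous fun z : ℂ => Complex.exp (Complex.I * (t * z)) := by fun_prop
    exact Continuous.mul (by fun_prop) (Complex.continuous_conj.comp h1)
  have heq : ∀ x : ℝ × ℝ, Complex.exp (Complex.I * (u * ((x.1 : ℂ) + Complex.I * (x.2 : ℂ)))) *
      starRingEnd ℂ (Complex.exp (Complex.I * (t * ((x.1 : ℂ) + Complex.I * (x.2 : ℂ)))))
      = Complex.exp (((u - t : ℝ) : ℂ) * x.1 * Complex.I) *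
        ((Real.exp (-(u + t) * x.2) : ℝ) : ℂ) := by
    intro x
    rw [← Complex.exp_conj, ← Complex.exp_add, Complex.ofReal_exp, ← Complex.exp_add]
    congr 1
    simp only [map_mul, map_add, Complex.conj_I, Complex.conj_ofReal]
    push_cast
    linear_combination ((u + t) * x.2 : ℂ) * Complex.I_sq
  have h1 : Integrable (fun x : ℝ => Complex.exp (((u - t : ℝ) : ℂ) * x * Complex.I))
      (gaussianReal 0 ((2 * s - ħ) / 2).toNNReal) := by
    refine (integrable_const (1 : ℝ)).mono' (by fun_prop) (.of_forall fun x => ?_)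
    rw [← Complex.ofReal_mul, Complex.norm_exp_ofReal_mul_I]
  have h2 : Integrable (fun x : ℝ => ((Real.exp (-(u + t) * x) : ℝ) : ℂ))
      (gaussianReal 0 (ħ / 2).toNNReal) := (integrable_exp_mul_gaussianReal _).ofReal
  constructor
  · rw [complexGaussian, integrable_map_measure (hf _) hm]
    exact (h1.mul_prod h2).congr (.of_forall fun x => (heq x).symm)
  · rw [complexGaussian, integral_map hm (hf _)]
    simp_rw [heq]
    rw [integral_prod_mul (f := fun x : ℝ => Complex.exp (((u - t : ℝ) : ℂ) * x * Complex.I))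
      (g := fun x : ℝ => ((Real.exp (-(u + t) * x) : ℝ) : ℂ)), ← charFun_apply_real,
      charFun_gaussianReal, integral_complex_ofReal]
    have h3 := congrFun (mgf_id_gaussianReal (μ := 0) (v := (ħ / 2).toNNReal)) (-(u + t))
    simp only [mgf, id] at h3
    rw [h3, Complex.ofReal_exp, ← Complex.exp_add]
    congr 1
    push_cast
    ring

variable {n : ℕ} {s ħ : ℝ}

lemma heatExt_character_mul_conj (hħ : 0 < ħ) (hs : 0 < s) (t u : Fin n → ℝ) (z : Fin n → ℂ) :
    heatExt s ħ (quadExp 0 fun k => Complex.I * u k) z *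
      starRingEnd ℂ (heatExt s ħ (quadExp 0 fun k => Complex.I * t k) z)
      = Complex.exp (-(ħ / 2 * ∑ k, (u k ^ 2 + t k ^ 2) : ℝ)) * ∏ k,
        (Complex.exp (Complex.I * (u k * z k)) *
          starRingEnd ℂ (Complex.exp (Complex.I * (t k * z k)))) := by
  rw [heatExt_character hħ hs, heatExt_character hħ hs, Finset.prod_mul_distrib, ← map_prod,
    ← Complex.exp_sum, ← Complex.exp_sum, ← Finset.mul_sum, ← Finset.mul_sum,
    Finset.sum_add_distrib, mul_add, Complex.ofReal_add, neg_add, Complex.exp_add, map_mul]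
  have : starRingEnd ℂ (Complex.exp (-(ħ / 2 * ∑ k, t k ^ 2 : ℝ)))
      = Complex.exp (-(ħ / 2 * ∑ k, t k ^ 2 : ℝ)) := by
    rw [← Complex.exp_conj, map_neg, Complex.conj_ofReal]
  rw [this]
  push_cast
  ring

lemma integrable_heatExt_character_mul_conj (hħ : 0 < ħ) (hs : 0 < s) (t u : Fin n → ℝ) :
    Integrable (fun z => heatExt s ħ (quadExp 0 fun k => Complex.I * u k) z *
      starRingEnd ℂ (heatExt s ħ (quadExp 0 fun k => Complex.I * t k) z))
      (Measure.pi fun _ => complexGaussian s ħ) := by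
  simp_rw [heatExt_character_mul_conj hħ hs]
  exact (Integrable.fintype_prod (μ := fun _ => complexGaussian s ħ) fun k =>
    (integrable_character_mul_conj_complexGaussian s ħ (t k) (u k)).1).const_mul _

lemma memLp_heatExt_character (hħ : 0 < ħ) (hs : ħ / 2 < s) (t : Fin n → ℝ) :
    MemLp (heatExt s ħ (quadExp 0 fun k => Complex.I * t k)) 2
      (Measure.pi fun _ => complexGaussian s ħ) := by
  have hs0 : 0 < s := by linarith
  have hc : Continuous (heatExt s ħ (quadExp 0 fun k => Complex.I * t k)) :=
    (differentiable_heatExt hħ hs (memLp_quadExp hs0 (by positivity) _)).continuous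
  rw [memLp_two_iff_integrable_sq_norm hc.aestronglyMeasurable]
  refine (integrable_heatExt_character_mul_conj hħ hs0 t t).norm.congr (.of_forall fun z => ?_)
  simp only
  rw [norm_mul, RCLike.norm_conj, sq]

/-- The source of the isometry: in each coordinate `-ħ(u²+t²)/2 + ħ(u+t)²/4 = -ħ(u-t)²/4`, and the
law of `q` contributes `-(2s-ħ)(u-t)²/4`, so `ħ` cancels. -/
lemma integral_heatExt_character_mul_conj (hħ : 0 < ħ) (hs : ħ / 2 < s) (t u : Fin n → ℝ) :
    ∫ z, heatExt s ħ (quadExp 0 fun k => Complex.I * u k) z *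
      starRingEnd ℂ (heatExt s ħ (quadExp 0 fun k => Complex.I * t k) z)
      ∂(Measure.pi fun _ => complexGaussian s ħ)
      = Complex.exp (-(s / 2 * ∑ k, (u k - t k) ^ 2 : ℝ)) := by
  have hs0 : 0 < s := by linarith
  have h1 : (((2 * s - ħ) / 2).toNNReal : ℝ) = (2 * s - ħ) / 2 :=
    Real.coe_toNNReal _ (by linarith)
  have h2 : ((ħ / 2).toNNReal : ℝ) = ħ / 2 := Real.coe_toNNReal _ (by linarith)
  simp_rw [heatExt_character_mul_conj hħ hs0]
  rw [integral_const_mul, integral_fintype_prod_eq_prod (μ := fun _ => complexGaussian s ħ)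
    (f := fun k (z : ℂ) => Complex.exp (Complex.I * (u k * z)) *
      starRingEnd ℂ (Complex.exp (Complex.I * (t k * z)))),
    Finset.prod_congr rfl fun k _ =>
      (integrable_character_mul_conj_complexGaussian s ħ (t k) (u k)).2,
    ← Complex.exp_sum, ← Complex.exp_add, h1, h2, ← Complex.ofReal_sum, ← Complex.ofReal_neg,
    ← Complex.ofReal_neg, ← Complex.ofReal_add, Finset.mul_sum, Finset.mul_sum,
    ← Finset.sum_neg_distrib, ← Finset.sum_neg_distrib, ← Finset.sum_add_distrib]
  congr 3
  funext k
  ring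

lemma integral_character_mul_conj (hs : 0 < s) (t u : Fin n → ℝ) :
    ∫ q, quadExp 0 (fun k => Complex.I * u k) q *
      starRingEnd ℂ (quadExp 0 (fun k => Complex.I * t k) q) ∂gaussian n s
      = Complex.exp (-(s / 2 * ∑ k, (u k - t k) ^ 2 : ℝ)) := by
  have h1 : ∀ q : Fin n → ℝ, quadExp 0 (fun k => Complex.I * u k) q *
      starRingEnd ℂ (quadExp 0 (fun k => Complex.I * t k) q)
      = ∏ k, Complex.exp (((u k - t k : ℝ) : ℂ) * q k * Complex.I) := by
    intro q
    simp only [quadExp]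
    rw [← Complex.exp_conj, ← Complex.exp_add, ← Complex.exp_sum]
    congr 1
    simp only [Complex.ofReal_zero, neg_zero, zero_mul, zero_add, map_sum, map_mul,
      Complex.conj_I, Complex.conj_ofReal]
    rw [← Finset.sum_add_distrib]
    refine Finset.sum_congr rfl fun k _ => ?_
    push_cast
    ring
  simp_rw [h1]
  rw [gaussian, integral_fintype_prod_eq_prod (μ := fun _ => gaussianReal 0 s.toNNReal)
    (f := fun k (x : ℝ) => Complex.exp (((u k - t k : ℝ) : ℂ) * x * Complex.I))]
  simp_rw [← charFun_apply_real, charFun_gaussianReal]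
  rw [← Complex.exp_sum]
  congr 1
  push_cast [Real.coe_toNNReal s hs.le]
  rw [Finset.mul_sum, ← Finset.sum_neg_distrib]
  refine Finset.sum_congr rfl fun k _ => ?_
  ring


end

/-! ### Characters on the spaces of connections and the isometry they determine -/

section

variable {𝔨 : Type*} [NormedAddCommGroup 𝔨] [InnerProductSpace ℝ 𝔨] {ι : Type*}
  (b : HilbertBasis ι ℝ (L2Connection 𝔨)) {s ħ : ℝ}

/-- It lets finitely many directions, and so several cylinder functions of them, be treated over one
common orthonormal system. -/
lemma exists_orthonormal_expansion {V : Type*} [NormedAddCommGroup V] [InnerProductSpace ℝ V]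
    {κ : Type*} [Finite κ] (v : κ → V) :
    ∃ (n : ℕ) (h : Fin n → V), Orthonormal ℝ h ∧ ∀ j, ∃ t : Fin n → ℝ, v j = ∑ k, t k • h k := by
  let W := Submodule.span ℝ (Set.range v)
  have : FiniteDimensional ℝ W := FiniteDimensional.span_of_finite ℝ (Set.finite_range v)
  let e := stdOrthonormalBasis ℝ W
  refine ⟨_, fun k => (e k : V), e.orthonormal.comp_linearIsometry W.subtypeₗᵢ, fun j => ?_⟩
  let w : W := ⟨v j, Submodule.subset_span ⟨j, rfl⟩⟩
  refine ⟨fun k => e.repr w k, ?_⟩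
  have := congrArg (Subtype.val : W → V) (e.sum_repr w)
  simpa using this.symm

lemma norm_sum_smul_sq_of_orthonormal {V : Type*} [NormedAddCommGroup V] [InnerProductSpace ℝ V]
    {n : ℕ} {h : Fin n → V} (hh : Orthonormal ℝ h) (t : Fin n → ℝ) :
    ‖∑ k, t k • h k‖ ^ 2 = ∑ k, t k ^ 2 := by
  rw [← real_inner_self_eq_norm_sq, hh.inner_sum]
  simp [sq]

/-- The character `A ↦ e^{i⟨c, A⟩}`. -/
def realCharacter (s : ℝ) (c : L2Connection 𝔨) (A : Connection ι) : ℂ :=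
  Complex.exp (Complex.I * pairing b s c A)

/-- The transform `Z ↦ e^{-ħ‖c‖²/2} e^{i⟨c, Z⟩}` of a character. -/
def complexCharacter (s ħ : ℝ) (c : L2Connection 𝔨) (Z : ComplexConnection ι) : ℂ :=
  Complex.exp (-(ħ / 2 * ‖c‖ ^ 2 : ℝ)) * Complex.exp (Complex.I * complexPairing b s ħ c Z)

lemma realCharacter_ae_eq {n : ℕ} (h : Fin n → L2Connection 𝔨) (t : Fin n → ℝ) :
    realCharacter b s (∑ k, t k • h k) =ᵐ[realMeasure ι s]
      cylinder b s h (quadExp 0 fun k => Complex.I * t k) := by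
  filter_upwards [coeFn_pairing_sum b t h] with A hA
  rw [realCharacter, hA, cylinder, quadExp]
  congr 1
  push_cast
  simp [Finset.mul_sum, mul_assoc]

lemma complexCharacter_ae_eq (hħ : 0 < ħ) (hs : 0 < s) {n : ℕ} {h : Fin n → L2Connection 𝔨}
    (hh : Orthonormal ℝ h) (t : Fin n → ℝ) :
    complexCharacter b s ħ (∑ k, t k • h k) =ᵐ[complexMeasure ι s ħ]
      complexCylinder b s ħ h (heatExt s ħ (quadExp 0 fun k => Complex.I * t k)) := by
  filter_upwards [coeFn_complexPairing_sum b t h] with Z hZ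
  rw [complexCharacter, hZ, complexCylinder, heatExt_character hħ hs,
    norm_sum_smul_sq_of_orthonormal hh]

lemma memLp_cylinder {n : ℕ} {h : Fin n → L2Connection 𝔨} (hh : Orthonormal ℝ h)
    {φ : (Fin n → ℝ) → ℂ} (hφ : MemLp φ 2 (gaussian n s)) :
    MemLp (cylinder b s h φ) 2 (realMeasure ι s) :=
  hφ.comp_measurePreserving (measurePreserving_pairing b hh)

lemma memLp_complexCylinder {n : ℕ} {h : Fin n → L2Connection 𝔨} (hh : Orthonormal ℝ h)
    {Φ : (Fin n → ℂ) → ℂ} (hΦ : MemLp Φ 2 (Measure.pi fun _ => complexGaussian s ħ)) :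
    MemLp (complexCylinder b s ħ h Φ) 2 (complexMeasure ι s ħ) :=
  hΦ.comp_measurePreserving (measurePreserving_complexPairing b hh)

lemma memLp_realCharacter (hs : 0 < s) (c : L2Connection 𝔨) :
    MemLp (realCharacter b s c) 2 (realMeasure ι s) := by
  obtain ⟨n, h, hh, ht⟩ := exists_orthonormal_expansion fun _ : Fin 1 => c
  obtain ⟨t, rfl⟩ := ht 0
  exact (memLp_cylinder b hh (memLp_quadExp hs (by positivity) _)).ae_eq
    (realCharacter_ae_eq b h t).symm

lemma memLp_complexCharacter (hħ : 0 < ħ) (hs : ħ / 2 < s) (c : L2Connection 𝔨) :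
    MemLp (complexCharacter b s ħ c) 2 (complexMeasure ι s ħ) := by
  obtain ⟨n, h, hh, ht⟩ := exists_orthonormal_expansion fun _ : Fin 1 => c
  obtain ⟨t, rfl⟩ := ht 0
  exact (memLp_complexCylinder b hh (memLp_heatExt_character hħ hs t)).ae_eq
    (complexCharacter_ae_eq b hħ (by linarith) hh t).symm

lemma inner_realCharacter (hħ : 0 < ħ) (hs : ħ / 2 < s) (hs0 : 0 < s) (c d : L2Connection 𝔨) :
    inner ℂ (memLp_realCharacter b hs0 c).toLp (memLp_realCharacter b hs0 d).toLp
      = inner ℂ (memLp_complexCharacter b hħ hs c).toLp (memLp_complexCharacter b hħ hs d).toLp := by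
  obtain ⟨n, h, hh, ht⟩ := exists_orthonormal_expansion ![c, d]
  obtain ⟨t, hct⟩ := ht 0
  obtain ⟨u, hdu⟩ := ht 1
  simp only [Matrix.cons_val_zero, Matrix.cons_val_one] at hct hdu
  subst hct hdu
  have h1 : inner ℂ (memLp_realCharacter b hs0 (∑ k, t k • h k)).toLp
      (memLp_realCharacter b hs0 (∑ k, u k • h k)).toLp
      = Complex.exp (-(s / 2 * ∑ k, (u k - t k) ^ 2 : ℝ)) := by
    have hX := measurePreserving_pairing b (s := s) hh
    rw [← integral_character_mul_conj hs0, ← hX.map_eq, integral_map hX.aemeasurable ?_,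
      L2.inner_def]
    · refine integral_congr_ae ?_
      filter_upwards [realCharacter_ae_eq b h t, realCharacter_ae_eq b h u,
        (memLp_realCharacter b hs0 (∑ k, t k • h k)).coeFn_toLp,
        (memLp_realCharacter b hs0 (∑ k, u k • h k)).coeFn_toLp] with A h1 h2 h3 h4
      rw [h3, h4, h1, h2, RCLike.inner_apply]
      rfl
    · exact ((continuous_quadExp _ _).mul
        (Complex.continuous_conj.comp (continuous_quadExp _ _))).aestronglyMeasurable
  have h2 : inner ℂ (memLp_complexCharacter b hħ hs (∑ k, t k • h k)).toLp
      (memLp_complexCharacter b hħ hs (∑ k, u k • h k)).toLp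
      = Complex.exp (-(s / 2 * ∑ k, (u k - t k) ^ 2 : ℝ)) := by
    have hX := measurePreserving_complexPairing b (s := s) (ħ := ħ) hh
    rw [← integral_heatExt_character_mul_conj hħ hs, ← hX.map_eq, integral_map hX.aemeasurable ?_,
      L2.inner_def]
    · refine integral_congr_ae ?_
      filter_upwards [complexCharacter_ae_eq b hħ hs0 hh t, complexCharacter_ae_eq b hħ hs0 hh u,
        (memLp_complexCharacter b hħ hs (∑ k, t k • h k)).coeFn_toLp,
        (memLp_complexCharacter b hħ hs (∑ k, u k • h k)).coeFn_toLp] with A h1 h2 h3 h4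
      rw [h3, h4, h1, h2, RCLike.inner_apply]
      rfl
    · rw [hX.map_eq]
      exact (integrable_heatExt_character_mul_conj hħ hs0 t u).aestronglyMeasurable
  rw [h1, h2]

instance (s : ℝ) : IsProbabilityMeasure (realMeasure ι s) := by
  unfold realMeasure
  infer_instance

/-- Finite real combinations of basis vectors already suffice: pairing with a basis vector is a
coordinate, so their characters are those of the finite-dimensional marginals. -/
lemma topologicalClosure_span_realCharacter (hs : 0 < s) :
    (Submodule.span ℂ (Set.range fun c : L2Connection 𝔨 =>
      (memLp_realCharacter b hs c).toLp)).topologicalClosure = ⊤ := by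
  refine topologicalClosure_span_eq_top_of_characters (μ := realMeasure ι s) fun J t =>
    ⟨_, ⟨∑ j : J, t j • b j, rfl⟩, ?_⟩
  have h1 : ∀ᵐ A ∂realMeasure ι s, ∀ j : J, pairing b s (b j) A = A j :=
    ae_all_iff.2 fun j => by
      rw [pairing_basis]
      exact (memLp_coord s (j : ι)).coeFn_toLp
  filter_upwards [(memLp_realCharacter b hs (∑ j : J, t j • b j)).coeFn_toLp, h1,
    coeFn_pairing_sum b t fun j : J => b j] with A h2 h3 h4
  rw [h2, realCharacter, h4]
  simp_rw [h3]

lemma topologicalClosure_span_character (hs : 0 < s) (n : ℕ) :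
    (Submodule.span ℂ (Set.range fun t : Fin n → ℝ => (memLp_quadExp hs
      (b := 0) (by positivity) fun k => Complex.I * t k).toLp)).topologicalClosure = ⊤ := by
  classical
  refine topologicalClosure_span_eq_top_of_characters (μ := gaussian n s) fun J t =>
    ⟨_, ⟨fun k => if hk : k ∈ J then t ⟨k, hk⟩ else 0, rfl⟩, ?_⟩
  refine (MemLp.coeFn_toLp _).trans (.of_forall fun q => ?_)
  rw [quadExp]
  congr 1
  have : ∑ j : J, t j * q j = ∑ k, (if hk : k ∈ J then t ⟨k, hk⟩ else 0) * q k := by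
    rw [← Finset.sum_subset (Finset.subset_univ J), ← Finset.sum_coe_sort J]
    · refine Finset.sum_congr rfl fun j _ => ?_
      simp
    · intro k _ hk
      simp [hk]
  rw [this]
  push_cast
  simp [Finset.mul_sum, mul_assoc]

/-- On cylinder functions over a fixed orthonormal system, an isometry that has the right values on
characters is given by the analytic continuation of the heat operator. -/
theorem ae_eq_complexCylinder_heatExt (hħ : 0 < ħ) (hs : ħ / 2 < s) {n : ℕ}
    (h : Fin n → L2Connection 𝔨) (V : Lp ℂ 2 (gaussian n s) →L[ℂ] Lp ℂ 2 (complexMeasure ι s ħ))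
    (hV : ∀ (t : Fin n → ℝ) (φ : Lp ℂ 2 (gaussian n s)),
      φ =ᵐ[gaussian n s] (quadExp 0 fun k => Complex.I * t k) → V φ =ᵐ[complexMeasure ι s ħ]
        complexCylinder b s ħ h (heatExt s ħ (quadExp 0 fun k => Complex.I * t k)))
    (φ : Lp ℂ 2 (gaussian n s)) :
    V φ =ᵐ[complexMeasure ι s ħ] complexCylinder b s ħ h (heatExt s ħ φ) := by
  have hsmul : ∀ (a : ℂ) (φ : Lp ℂ 2 (gaussian n s)),
      V φ =ᵐ[complexMeasure ι s ħ] complexCylinder b s ħ h (heatExt s ħ φ) →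
      V (a • φ) =ᵐ[complexMeasure ι s ħ]
        complexCylinder b s ħ h (heatExt s ħ (a • φ : Lp ℂ 2 (gaussian n s))) := by
    intro a φ hφ
    rw [heatExt_congr_ae (Lp.coeFn_smul a φ), map_smul]
    filter_upwards [hφ, Lp.coeFn_smul a (V φ)] with Z h1 h2
    rw [h2, Pi.smul_apply, h1, complexCylinder, complexCylinder, heatExt_smul, smul_eq_mul]
  let W : Submodule ℂ (Lp ℂ 2 (gaussian n s)) :=
    { carrier := {φ | V φ =ᵐ[complexMeasure ι s ħ] complexCylinder b s ħ h (heatExt s ħ φ)}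
      add_mem' := by
        intro φ ψ hφ hψ
        rw [Set.mem_ofPred_eq, heatExt_congr_ae (Lp.coeFn_add φ ψ), map_add]
        filter_upwards [hφ, hψ, Lp.coeFn_add (V φ) (V ψ)] with Z h1 h2 h3
        rw [h3, Pi.add_apply, h1, h2, complexCylinder, complexCylinder, complexCylinder,
          heatExt_add hħ hs (Lp.memLp φ) (Lp.memLp ψ)]
      zero_mem' := by
        have h1 : heatExt s ħ ((0 : Lp ℂ 2 (gaussian n s)) : (Fin n → ℝ) → ℂ) = 0 := by
          rw [heatExt_congr_ae (Lp.coeFn_zero ℂ 2 (gaussian n s))]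
          funext z
          simp [heatExt]
        rw [Set.mem_ofPred_eq, h1, map_zero]
        exact Lp.coeFn_zero _ _ _
      smul_mem' := hsmul }
  have hclosed : IsClosed (W : Set (Lp ℂ 2 (gaussian n s))) := by
    refine IsSeqClosed.isClosed fun u φ hu hφ => ?_
    have h1 : Filter.Tendsto (fun j => V (u j)) Filter.atTop (nhds (V φ)) :=
      (V.continuous.tendsto φ).comp hφ
    -- A subsequence of the left sides converges almost everywhere, while the right sides converge
    -- at every point by `continuous_heatExt_apply`.
    obtain ⟨ns, hns, hlim⟩ := (tendstoInMeasure_of_tendsto_Lp h1).exists_seq_tendsto_ae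
    have h2 : ∀ᵐ Z ∂complexMeasure ι s ħ, ∀ j,
        V (u j) Z = complexCylinder b s ħ h (heatExt s ħ (u j)) Z := ae_all_iff.2 fun j => hu j
    change V φ =ᵐ[complexMeasure ι s ħ] complexCylinder b s ħ h (heatExt s ħ φ)
    filter_upwards [hlim, h2] with Z h3 h4
    simp only [h4] at h3
    refine tendsto_nhds_unique h3 ?_
    exact ((continuous_heatExt_apply hħ hs _).tendsto φ).comp (hφ.comp hns.tendsto_atTop)
  have hs0 : 0 < s := by linarith
  have htop : (⊤ : Submodule ℂ (Lp ℂ 2 (gaussian n s))) ≤ W := by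
    rw [← topologicalClosure_span_character hs0 n]
    refine Submodule.topologicalClosure_minimal _ (Submodule.span_le.2 ?_) hclosed
    rintro _ ⟨t, rfl⟩
    change _ =ᵐ[complexMeasure ι s ħ] _
    rw [heatExt_congr_ae (MemLp.coeFn_toLp _)]
    exact hV t _ (MemLp.coeFn_toLp _)
  exact htop (Submodule.mem_top (x := φ))

/-- The property that characterizes the transform: it has the right values on cylinder functions. -/
def IsSegalBargmann (U : Lp ℂ 2 (realMeasure ι s) →ₗᵢ[ℂ] Lp ℂ 2 (complexMeasure ι s ħ)) : Prop :=
  ∀ {n : ℕ} {h : Fin n → L2Connection 𝔨} {φ : (Fin n → ℝ) → ℂ}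
    {f : Lp ℂ 2 (realMeasure ι s)}, Orthonormal ℝ h → MemLp φ 2 (gaussian n s) →
    f =ᵐ[realMeasure ι s] cylinder b s h φ →
    U f =ᵐ[complexMeasure ι s ħ] complexCylinder b s ħ h (heatExt s ħ φ)

/-- `U` is built from all characters at once and only then restricted to each orthonormal system.
One operator thus serves every representation. -/
theorem exists_isSegalBargmann (hħ : 0 < ħ) (hs : ħ / 2 < s) :
    ∃ U : Lp ℂ 2 (realMeasure ι s) →ₗᵢ[ℂ] Lp ℂ 2 (complexMeasure ι s ħ), IsSegalBargmann b U := by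
  have hs0 : 0 < s := by linarith
  obtain ⟨U, hU⟩ := exists_linearIsometry_of_inner_eq (topologicalClosure_span_realCharacter b hs0)
    (inner_realCharacter b hħ hs hs0)
  refine ⟨U, fun {n h φ f} hh hφ hf => ?_⟩
  have hX := measurePreserving_pairing b (s := s) hh
  -- The isometric embedding of `n`-variable functions as cylinder functions over `h`.
  let C : Lp ℂ 2 (gaussian n s) →ₗᵢ[ℂ] Lp ℂ 2 (realMeasure ι s) :=
    Lp.compMeasurePreservingₗᵢ ℂ _ hX
  have hC : ∀ ψ : Lp ℂ 2 (gaussian n s), C ψ =ᵐ[realMeasure ι s] cylinder b s h ψ := fun ψ =>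
    Lp.coeFn_compMeasurePreserving ψ hX
  have hcyl : ∀ {ψ ψ' : (Fin n → ℝ) → ℂ}, ψ =ᵐ[gaussian n s] ψ' →
      cylinder b s h ψ =ᵐ[realMeasure ι s] cylinder b s h ψ' := fun hψ =>
    hX.quasiMeasurePreserving.ae_eq_comp hψ
  have key := ae_eq_complexCylinder_heatExt b hħ hs h (U.comp C).toContinuousLinearMap ?_ hφ.toLp
  · rw [heatExt_congr_ae hφ.coeFn_toLp] at key
    have h1 : C hφ.toLp = f :=
      Lp.ext ((hC _).trans ((hcyl hφ.coeFn_toLp).trans hf.symm))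
    have h2 : U f = (U.comp C).toContinuousLinearMap hφ.toLp := by
      rw [← h1]
      rfl
    rw [h2]
    exact key
  · intro t ψ hψ
    have h1 : C ψ = (memLp_realCharacter b hs0 (∑ k, t k • h k)).toLp :=
      Lp.ext ((hC _).trans ((hcyl hψ).trans
        ((realCharacter_ae_eq b h t).symm.trans (MemLp.coeFn_toLp _).symm)))
    have h2 : (U.comp C).toContinuousLinearMap ψ
        = (memLp_complexCharacter b hħ hs (∑ k, t k • h k)).toLp := by
      rw [← hU, ← h1]
      rfl
    rw [h2]
    exact (MemLp.coeFn_toLp _).trans (complexCharacter_ae_eq b hħ hs0 hh t)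

end

/-! ### The range of the transform -/

section

variable {𝔨 : Type*} [NormedAddCommGroup 𝔨] [InnerProductSpace ℝ 𝔨] {ι : Type*}
  (b : HilbertBasis ι ℝ (L2Connection 𝔨)) {s ħ : ℝ}

/-- A finite combination of characters is a cylinder function over an orthonormal system for the
span of its directions, and such combinations are dense. -/
lemma dense_isCylinder (hs : 0 < s) : Dense {f | IsCylinder b s f} := by
  refine ((Submodule.dense_iff_topologicalClosure_eq_top).2
    (topologicalClosure_span_realCharacter b hs)).mono fun f hf => ?_
  obtain ⟨a, rfl⟩ := Finsupp.mem_span_range_iff_exists_finsupp.1 hf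
  obtain ⟨n, h, hh, ht⟩ := exists_orthonormal_expansion fun c : a.support => (c : L2Connection 𝔨)
  choose t ht using ht
  refine ⟨n, h, fun q => ∑ c : a.support, a c * quadExp 0 (fun k => Complex.I * t c k) q, hh,
    memLp_finsetSum _ fun c _ => (memLp_quadExp hs (by positivity) _).const_mul _, ?_⟩
  have h1 : ∀ᵐ A ∂realMeasure ι s, ∀ c : a.support,
      (a c • (memLp_realCharacter b hs (c : L2Connection 𝔨)).toLp :
        Lp ℂ 2 (realMeasure ι s)) A = a c * cylinder b s h (quadExp 0 fun k => Complex.I * t c k) A :=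
    ae_all_iff.2 fun c => by
      have h2 := realCharacter_ae_eq b (s := s) h (t c)
      rw [← ht c] at h2
      filter_upwards [h2, Lp.coeFn_smul (a c) (memLp_realCharacter b hs (c : L2Connection 𝔨)).toLp,
        (memLp_realCharacter b hs (c : L2Connection 𝔨)).coeFn_toLp] with A h3 h4 h5
      rw [h4, Pi.smul_apply, h5, h3, smul_eq_mul]
  rw [Finsupp.sum, ← Finset.sum_coe_sort a.support]
  filter_upwards [h1, Lp.coeFn_finsetSum Finset.univ fun c : a.support =>
    a c • (memLp_realCharacter b hs (c : L2Connection 𝔨)).toLp] with A h2 h3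
  rw [h3, Finset.sum_apply, cylinder]
  exact Finset.sum_congr rfl fun c _ => h2 c

variable {n : ℕ} {h : Fin n → L2Connection 𝔨} {Φ Ψ : (Fin n → ℂ) → ℂ}
  {F G : Lp ℂ 2 (complexMeasure ι s ħ)}

lemma memLp_of_ae_eq_complexCylinder (hh : Orthonormal ℝ h) (hΦ : Continuous Φ)
    (hF : F =ᵐ[complexMeasure ι s ħ] complexCylinder b s ħ h Φ) :
    MemLp Φ 2 (Measure.pi fun _ => complexGaussian s ħ) := by
  have hX := measurePreserving_complexPairing b (s := s) (ħ := ħ) hh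
  rw [← hX.map_eq, memLp_map_measure_iff hΦ.aestronglyMeasurable hX.aemeasurable]
  exact (Lp.memLp F).ae_eq hF

lemma inner_eq_integral_of_ae_eq_complexCylinder (hh : Orthonormal ℝ h) (hΦ : Continuous Φ)
    (hΨ : Continuous Ψ) (hF : F =ᵐ[complexMeasure ι s ħ] complexCylinder b s ħ h Φ)
    (hG : G =ᵐ[complexMeasure ι s ħ] complexCylinder b s ħ h Ψ) :
    inner ℂ F G = ∫ z, starRingEnd ℂ (Φ z) * Ψ z ∂(Measure.pi fun _ => complexGaussian s ħ) := by
  have hX := measurePreserving_complexPairing b (s := s) (ħ := ħ) hh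
  have hc : Continuous fun z => starRingEnd ℂ (Φ z) * Ψ z := (Complex.continuous_conj.comp hΦ).mul hΨ
  rw [← hX.map_eq, integral_map hX.aemeasurable hc.aestronglyMeasurable, L2.inner_def]
  refine integral_congr_ae ?_
  filter_upwards [hF, hG] with Z h1 h2
  rw [h1, h2, RCLike.inner_apply, mul_comm]
  rfl

variable {b} {U : Lp ℂ 2 (realMeasure ι s) →ₗᵢ[ℂ] Lp ℂ 2 (complexMeasure ι s ħ)}

lemma IsSegalBargmann.apply_eq (hU : IsSegalBargmann b U) (hħ : 0 < ħ) (hs : ħ / 2 < s)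
    {f : Lp ℂ 2 (realMeasure ι s)} (hf : IsTransform b s ħ f F) : U f = F := by
  obtain ⟨n, h, φ, Φ, hh, hφ, hfφ, hΦ, hF⟩ := hf
  rw [hΦ.eq_heatExt hħ hs hφ] at hF
  exact Lp.ext ((hU hh hφ hfφ).trans hF.symm)

lemma IsSegalBargmann.isTransform (hU : IsSegalBargmann b U) (hħ : 0 < ħ) (hs : ħ / 2 < s)
    {f : Lp ℂ 2 (realMeasure ι s)} (hf : IsCylinder b s f) : IsTransform b s ħ f (U f) := by
  obtain ⟨n, h, φ, hh, hφ, hfφ⟩ := hf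
  exact ⟨n, h, φ, heatExt s ħ φ, hh, hφ, hfφ, isAnalyticContinuation_heatExt hħ hs hφ,
    hU hh hφ hfφ⟩

lemma IsTransform.mem_HL2 {f : Lp ℂ 2 (realMeasure ι s)} (hf : IsTransform b s ħ f F) :
    F ∈ HL2 b s ħ := by
  obtain ⟨n, h, φ, Φ, hh, -, -, hΦ, hF⟩ := hf
  exact Submodule.le_topologicalClosure _ (Submodule.subset_span ⟨n, h, Φ, hh, hΦ.1, hF⟩)

lemma IsSegalBargmann.range_le (hU : IsSegalBargmann b U) (hħ : 0 < ħ) (hs : ħ / 2 < s) :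
    LinearMap.range U.toLinearMap ≤ HL2 b s ħ := by
  rintro _ ⟨f, rfl⟩
  have hc : IsClosed {f | U f ∈ HL2 b s ħ} :=
    (Submodule.isClosed_topologicalClosure _).preimage U.continuous
  refine (dense_isCylinder b (by linarith : 0 < s)).induction (P := fun f => U f ∈ HL2 b s ħ)
    (fun f hf => ?_) hc f
  exact (hU.isTransform hħ hs hf).mem_HL2

/-- The projection is onto the range of the transform over the same `h`, not onto that of `U`. This
keeps the remainder an entire function of the same `n` variables, to which the coherent state
argument applies. -/
lemma IsSegalBargmann.mem_range_of_isHolomorphicCylinder (hU : IsSegalBargmann b U) (hħ : 0 < ħ)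
    (hs : ħ / 2 < s) (hF : IsHolomorphicCylinder b s ħ F) : F ∈ LinearMap.range U.toLinearMap := by
  obtain ⟨n, h, Φ, hh, hΦ, hF⟩ := hF
  have hX := measurePreserving_pairing b (s := s) hh
  let C : Lp ℂ 2 (gaussian n s) →ₗᵢ[ℂ] Lp ℂ 2 (realMeasure ι s) :=
    Lp.compMeasurePreservingₗᵢ ℂ _ hX
  let T := U.comp C
  have hT : ∀ {ψ : (Fin n → ℝ) → ℂ} (hψ : MemLp ψ 2 (gaussian n s)),
      T hψ.toLp =ᵐ[complexMeasure ι s ħ] complexCylinder b s ħ h (heatExt s ħ ψ) := by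
    intro ψ hψ
    refine hU hh hψ ((Lp.coeFn_compMeasurePreserving hψ.toLp hX).trans ?_)
    exact hX.quasiMeasurePreserving.ae_eq_comp hψ.coeFn_toLp
  have hcl : IsClosed (LinearMap.range T.toLinearMap : Set (Lp ℂ 2 (complexMeasure ι s ħ))) := by
    have := T.isometry.isClosedEmbedding.isClosed_range
    rwa [LinearMap.coe_range]
  have : CompleteSpace (LinearMap.range T.toLinearMap) := hcl.completeSpace_coe
  obtain ⟨_, ⟨φ, rfl⟩, G, hG, hFG⟩ :=
    (LinearMap.range T.toLinearMap).exists_add_mem_mem_orthogonal F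
  have hφ := Lp.memLp φ
  have hTφ : T φ =ᵐ[complexMeasure ι s ħ] complexCylinder b s ħ h (heatExt s ħ φ) := by
    have := hT hφ
    rwa [Lp.toLp_coeFn] at this
  have hd : Differentiable ℂ (Φ - heatExt s ħ φ) := hΦ.sub (differentiable_heatExt hħ hs hφ)
  have hGeq : G =ᵐ[complexMeasure ι s ħ] complexCylinder b s ħ h (Φ - heatExt s ħ φ) := by
    have h1 : G = F - T φ := by
      rw [hFG]
      exact (add_sub_cancel_left (T φ) G).symm
    rw [h1]
    filter_upwards [hF, hTφ, Lp.coeFn_sub F (T φ)] with Z h2 h3 h4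
    rw [h4, Pi.sub_apply, h2, h3]
    rfl
  have h0 : Φ - heatExt s ħ φ = 0 := by
    have hmG := memLp_of_ae_eq_complexCylinder b hh hd.continuous hGeq
    -- Each coherent state, up to a nonzero factor, lies in the range of `T`; this yields both its
    -- square integrability and its orthogonality to `G`.
    have hw : ∀ w : Fin n → ℂ, ∃ K : ℂ, K ≠ 0 ∧ ∃ ψ : Lp ℂ 2 (gaussian n s),
        T ψ =ᵐ[complexMeasure ι s ħ] complexCylinder b s ħ h (K • coherentState s ħ w) := by
      intro w
      obtain ⟨r, c, K, hK, hm, heq⟩ := exists_heatExt_eq_coherentState hħ hs w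
      refine ⟨K, hK, hm.toLp, ?_⟩
      have h1 : heatExt s ħ (quadExp r c) = K • coherentState s ħ w := funext heq
      rw [← h1]
      exact hT hm
    have hcont : ∀ w : Fin n → ℂ, Continuous (coherentState s ħ w) := fun w => by
      unfold coherentState
      fun_prop
    refine eq_zero_of_orthogonal_coherentState hħ hs hd (fun w => ?_) fun w => ?_
    · obtain ⟨K, hK, ψ, hψ⟩ := hw w
      have h1 := (memLp_of_ae_eq_complexCylinder b hh ((hcont w).const_smul K) hψ).const_smul K⁻¹
      rw [inv_smul_smul₀ hK] at h1
      exact h1.star.integrable_mul hmG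
    · obtain ⟨K, hK, ψ, hψ⟩ := hw w
      have h1 := (Submodule.mem_orthogonal _ _).1 hG (T ψ) ⟨ψ, rfl⟩
      rw [inner_eq_integral_of_ae_eq_complexCylinder b hh ((hcont w).const_smul K) hd.continuous
        hψ hGeq] at h1
      simp only [Pi.smul_apply, smul_eq_mul, map_mul, mul_assoc] at h1
      rw [integral_const_mul] at h1
      exact (mul_eq_zero.1 h1).resolve_left ((map_ne_zero _).2 hK)
  refine ⟨C φ, ?_⟩
  refine Lp.ext (hTφ.trans ?_)
  rw [← sub_eq_zero.1 h0]
  exact hF.symm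

/-- The range of an isometry of a complete space is closed, so containing the holomorphic cylinder
functions it contains the closure of their span. -/
theorem IsSegalBargmann.range_eq (hU : IsSegalBargmann b U) (hħ : 0 < ħ) (hs : ħ / 2 < s) :
    LinearMap.range U.toLinearMap = HL2 b s ħ := by
  refine le_antisymm (hU.range_le hħ hs) ?_
  have hcl : IsClosed (LinearMap.range U.toLinearMap : Set (Lp ℂ 2 (complexMeasure ι s ħ))) := by
    have := U.isometry.isClosedEmbedding.isClosed_range
    rwa [LinearMap.coe_range]
  exact Submodule.topologicalClosure_minimal _
    (Submodule.span_le.2 fun F hF => hU.mem_range_of_isHolomorphicCylinder hħ hs hF) hcl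

end

end SegalBargmann

end

/-! ### The unitary transform -/

theorem mainTheorem3 {𝔨 : Type*} [NormedAddCommGroup 𝔨] [InnerProductSpace ℝ 𝔨]
    [FiniteDimensional ℝ 𝔨] {ι : Type*} (b : HilbertBasis ι ℝ (L2Connection 𝔨))
    (s ħ : ℝ) (hħ : 0 < ħ) (hs : ħ / 2 < s) :
    -- for every representation of a cylinder function, the heat integrals converge, there is
    -- exactly one analytic continuation, and it gives an element of `L²(𝒜_ℂ, M_{s,ħ})`
    (∀ (n : ℕ) (h : Fin n → L2Connection 𝔨) (φ : (Fin n → ℝ) → ℂ),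
      Orthonormal ℝ h → MemLp φ 2 (gaussian n s) →
        MemLp (cylinder b s h φ) 2 (realMeasure ι s) ∧
        (∀ x, Integrable (fun q => (heatKernel ħ x q : ℂ) * φ q)) ∧
        (∃! Φ, IsAnalyticContinuation (heat ħ φ) Φ) ∧
        (∀ Φ, IsAnalyticContinuation (heat ħ φ) Φ →
          MemLp (complexCylinder b s ħ h Φ) 2 (complexMeasure ι s ħ))) ∧
    -- the transform of a cylinder function does not depend on the representation
    (∀ f, IsCylinder b s f → ∃! F, IsTransform b s ħ f F) ∧
    -- it is isometric on cylinder functions, with values in `ℋL²(𝒜_ℂ, M_{s,ħ})`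
    (∀ f F, IsTransform b s ħ f F → F ∈ HL2 b s ħ ∧ ‖F‖ = ‖f‖) ∧
    (∀ f g F G, IsTransform b s ħ f F → IsTransform b s ħ g G → ‖F - G‖ = ‖f - g‖) ∧
    -- it extends by continuity to a unitary map onto `ℋL²(𝒜_ℂ, M_{s,ħ})`
    Dense {f | IsCylinder b s f} ∧
    ∃! U : Lp ℂ 2 (realMeasure ι s) ≃ₗᵢ[ℂ] HL2 b s ħ,
      ∀ f F, IsTransform b s ħ f F → (U f : Lp ℂ 2 (complexMeasure ι s ħ)) = F := by
  have hs0 : 0 < s := by linarith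
  obtain ⟨U, hU⟩ := exists_isSegalBargmann b hħ hs
  have hUeq : ∀ f F, IsTransform b s ħ f F → U f = F := fun f F hf => hU.apply_eq hħ hs hf
  refine ⟨fun n h φ hh hφ => ⟨memLp_cylinder b hh hφ, integrable_heatKernel_mul hħ hs hφ,
    ⟨heatExt s ħ φ, isAnalyticContinuation_heatExt hħ hs hφ, fun Φ hΦ => hΦ.eq_heatExt hħ hs hφ⟩,
    fun Φ hΦ => ?_⟩, fun f hf => ⟨U f, hU.isTransform hħ hs hf, fun F hF => (hUeq f F hF).symm⟩,
    fun f F hF => ⟨hF.mem_HL2, ?_⟩, fun f g F G hF hG => ?_, dense_isCylinder b hs0, ?_⟩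
  · rw [hΦ.eq_heatExt hħ hs hφ]
    exact (Lp.memLp _).ae_eq (hU hh hφ (memLp_cylinder b hh hφ).coeFn_toLp)
  · rw [← hUeq f F hF, U.norm_map]
  · rw [← hUeq f F hF, ← hUeq g G hG, ← map_sub, U.norm_map]
  · refine ⟨U.equivRange.trans (LinearIsometryEquiv.ofEq _ _ (hU.range_eq hħ hs)),
      fun f F hF => hUeq f F hF, fun V hV => ?_⟩
    refine LinearIsometryEquiv.ext fun f => Subtype.ext ?_
    refine (dense_isCylinder b hs0).induction
      (P := fun f => (V f : Lp ℂ 2 (complexMeasure ι s ħ)) = U f) (fun f hf => ?_)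
      (isClosed_eq (continuous_subtype_val.comp V.continuous) U.continuous) f
    exact hV f _ (hU.isTransform hħ hs hf)
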